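/- Let $n_1\le n_2$ be positive even integers such that either $n_1<n_2$ or $n_1=n_2\notin\{4,8,12,16\}$. Put $t_i=n_i/2$, let $I=\{1,\dots,n_1\}\times\{1,\dots,n_2\}$ (first coordinate = row, second coordinate = column), let $d((x_1,x_2),(y_1,y_2))=|x_1-y_1|+|x_2-y_2|$, and let $N$ be the set of unordered pairs $\{x,y\}$ of cells of $I$ with $d(x,y)=1$ (neighbors). For a permutation $\pi$ of $I$, viewed as an array with the entry $\pi(i,j)$ in row $i$ and column $j$, let $$f(\pi)=\sum_{\{x,y\}\in N}d(\pi(x),\pi(y)).$$ Let $O=((n_1+1)/2,(n_2+1)/2)$ be the center of $I$, let $\Lambda_i=\{x\in I: d(x,O)=i\}$ be the $i$-th layer, for $A\subseteq I$ let $w(A)=\sum_{x\in A}d(x,O)$, and let $w_k(n_1,n_2)$ be the minimum of $w(A)$ over all $A\subseteq I$ with $|A|=k$. Call a value $u$ of the $i$-th coordinate small if $u\le t_i$ and large if $u>t_i$. The kind of a cell records which of its two coordinates are small (four kinds); a cell is homogeneous if its coordinates are both small or both large, and heterogeneous otherwise. The values of the $i$-th coordinate of $\pi$ at two neighbors form a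 defect if both are small, the value of the defect being their maximum, or if both are large, the value of the defect being their minimum; it is a row defect if $i=1$ and a column defect if $i=2$. Let $\mathcal P_v(n_1,n_2)$ be the set of all permutations $\pi$ of $I$ such that 1. the set of the values of $\pi$ at the four corners of $I$ is $\Lambda_1$; 2. all values of $\pi$ in one of the two halves of the grid (columns $1,\dots,t_2$ and columns $t_2+1,\dots,n_2$) are homogeneous and all values in the other half are heterogeneous; 3. (double checkerboard) if $x$, $y$ are neighbors in the same half, then exactly one of $\pi(x)_1,\pi(y)_1$ is small and exactly one of $\pi(x)_2,\pi(y)_2$ is small; 4. the set $E$ of values of $\pi$ at the boundary cells (corners included) is filled layer by layer, that is, if $x\in E$, $y\in I$ and $d(y,O)<d(x,O)$ then $y\in E$; and $E$ has the same number of elements of each of the four kinds; 5. for some $i\in\{1,2\}$, in every row the two cells in columns $t_2$ and $t_2+1$ form a defect in the $i$-th coordinate, and the values of these defects alternate, from row to row, between $t_i$ and $t_i+1$. Let $\mathcal P(n_1,n_2)=\mathcal P_v(n_1,n_2)$ if $n_1<n_2$. If $n_1=n_2$, let $\mathcal P(n_1,n_2)$ consist of the members of $\mathcal P_v(n_1,n_2)$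 and of their transposes, where the transpose of $\pi$ is $\tau\pi\tau$ with $\tau(i,j)=(j,i)$. Then $\mathcal P(n_1,n_2)$ is not empty, $f$ attains its maximum at $\pi$ if and only if $\pi\in\mathcal P(n_1,n_2)$, and this maximum is equal to $$n_1n_2(n_1+n_2)-4-n_1-w_{2n_1+2n_2-4}(n_1,n_2).$$ Here, with $k=2n_1+2n_2-4$ and for every integer $r\ge 0$ such that $\sum_{i=1}^r|\Lambda_i|\le k\le\sum_{i=1}^{r+1}|\Lambda_i|$, $$w_k(n_1,n_2)=\sum_{i=1}^r i|\Lambda_i|+(r+1)\Bigl(k-\sum_{i=1}^r|\Lambda_i|\Bigr).$$ -/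

import Mathlib

namespace GridSep

/-- The cells of the grid `{1,…,n₁} × {1,…,n₂}`, with 1-based coordinates: the first coordinate
is the row, the second one is the column. -/
abbrev Cell (n₁ n₂ : ℕ) : Type :=
  ↥(Finset.Icc (1 : ℤ) n₁ ×ˢ Finset.Icc (1 : ℤ) n₂)

/-- The `L₁` metric on `ℤ × ℤ`. -/
def l1 (x y : ℤ × ℤ) : ℤ := |x.1 - y.1| + |x.2 - y.2|

theorem l1_comm (x y : ℤ × ℤ) : l1 x y = l1 y x := by
  simp only [l1, abs_sub_comm]

/-- The `L₁` distance between the two members of an unordered pair. -/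
def pairDist : Sym2 (ℤ × ℤ) → ℤ := Sym2.lift ⟨l1, l1_comm⟩

/-- The set of unordered pairs `{x, y}` of cells with `d(x, y) = 1`. -/
noncomputable def neighborPairs (n₁ n₂ : ℕ) : Finset (Sym2 (Cell n₁ n₂)) :=
  {e | pairDist (e.map Subtype.val) = 1}

/-- The sum of `d(π(x), π(y))` over all unordered pairs `{x, y}` of neighbors. -/
noncomputable def separation {n₁ n₂ : ℕ} (π : Equiv.Perm (Cell n₁ n₂)) : ℤ :=
  ∑ e ∈ neighborPairs n₁ n₂, pairDist (e.map fun x => (π x : ℤ × ℤ))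

section Disks

/-- The `L₁` distance of a cell to the center `((n₁ + 1)/2, (n₂ + 1)/2)` of the grid. -/
noncomputable def centerDist {n₁ n₂ : ℕ} (x : Cell n₁ n₂) : ℝ :=
  |(x.1.1 : ℝ) - ((n₁ : ℝ) + 1) / 2| + |(x.1.2 : ℝ) - ((n₂ : ℝ) + 1) / 2|

/-- The total distance of the members of `A` to the center of the grid. -/
noncomputable def weight {n₁ n₂ : ℕ} (A : Finset (Cell n₁ n₂)) : ℝ := ∑ x ∈ A, centerDist x

/-- `w_k(n₁, n₂)`: the least total distance to the center of a set of `k` cells. -/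
noncomputable def minWeight (n₁ n₂ k : ℕ) : ℝ :=
  sInf {s | ∃ A : Finset (Cell n₁ n₂), A.card = k ∧ s = weight A}

/-- The infimum in `minWeight` is a minimum as soon as the grid has `k` cells. -/
theorem isLeast_minWeight {n₁ n₂ k : ℕ} (hk : k ≤ n₁ * n₂) :
    IsLeast {s | ∃ A : Finset (Cell n₁ n₂), A.card = k ∧ s = weight A} (minWeight n₁ n₂ k) := by
  have hfin : {s | ∃ A : Finset (Cell n₁ n₂), A.card = k ∧ s = weight A}.Finite := by
    refine (Set.finite_range (weight (n₁ := n₁) (n₂ := n₂))).subset ?_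
    rintro s ⟨A, -, rfl⟩
    exact ⟨A, rfl⟩
  have hcard : k ≤ (Finset.univ : Finset (Cell n₁ n₂)).card := by
    simpa using hk
  obtain ⟨A, -, hA⟩ := Finset.exists_subset_card_eq hcard
  have hne : {s | ∃ A : Finset (Cell n₁ n₂), A.card = k ∧ s = weight A}.Nonempty :=
    ⟨_, A, hA, rfl⟩
  exact ⟨hne.csInf_mem hfin, fun s hs => csInf_le hfin.bddBelow hs⟩

open Classical in
/-- The layer `Λ_i`: the cells at distance `i` from the center. -/
noncomputable def layer (n₁ n₂ i : ℕ) : Finset (Cell n₁ n₂) := {x | centerDist x = i}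

end Disks

section Construction

/-- The largest small value of a coordinate that runs through `{1,…,n}`, `n` even:
`1,…,n/2` are the small values, `n/2 + 1,…,n` the large ones. -/
def half (n : ℕ) : ℤ := (n : ℤ) / 2

/-- The kind of a cell: whether its first (second) coordinate is small. -/
def kind {n₁ n₂ : ℕ} (x : Cell n₁ n₂) : Bool × Bool :=
  (decide (x.1.1 ≤ half n₁), decide (x.1.2 ≤ half n₂))

/-- A cell is homogeneous if its coordinates are both small or both large; otherwise it is
heterogeneous. -/
def Homogeneous {n₁ n₂ : ℕ} (x : Cell n₁ n₂) : Prop := (kind x).1 = (kind x).2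

/-- The values of `π` on the four corners. -/
noncomputable def cornerValues {n₁ n₂ : ℕ} (π : Equiv.Perm (Cell n₁ n₂)) : Finset (Cell n₁ n₂) :=
  ({x | (x.1.1 = 1 ∨ x.1.1 = n₁) ∧ (x.1.2 = 1 ∨ x.1.2 = n₂)} : Finset (Cell n₁ n₂)).image π

/-- The values of `π` on the boundary of the grid, corners included. -/
noncomputable def boundaryValues {n₁ n₂ : ℕ} (π : Equiv.Perm (Cell n₁ n₂)) : Finset (Cell n₁ n₂) :=
  ({x | x.1.1 = 1 ∨ x.1.1 = n₁ ∨ x.1.2 = 1 ∨ x.1.2 = n₂} : Finset (Cell n₁ n₂)).image π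

/-- Two values `a`, `b` (of the coordinate that runs through `{1,…,n}`) in neighboring cells
form a defect with value `v`: both are small and `v` is their maximum, or both are large and `v`
is their minimum. -/
def IsDefect (n : ℕ) (a b v : ℤ) : Prop :=
  (a ≤ half n ∧ b ≤ half n ∧ v = max a b) ∨ (half n < a ∧ half n < b ∧ v = min a b)

/-- In every row, the two cells next to the vertical line that bisects the grid form a defect in
the coordinate `c` of the values of `π` (a coordinate that runs through `{1,…,n}`), and from row
to row the values of these defects alternate between `n/2` and `n/2 + 1`. -/
def AlternatingDefects {n₁ n₂ : ℕ} (π : Equiv.Perm (Cell n₁ n₂)) (n : ℕ) (c : ℤ × ℤ → ℤ) : Prop :=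
  ∃ v : ℤ → ℤ,
    (∀ x y : Cell n₁ n₂, x.1.1 = y.1.1 → x.1.2 = half n₂ → y.1.2 = half n₂ + 1 →
      IsDefect n (c (π x)) (c (π y)) (v x.1.1)) ∧
    (∀ i : ℤ, 1 ≤ i → i ≤ n₁ → v i = half n ∨ v i = half n + 1) ∧
    (∀ i : ℤ, 1 ≤ i → i < n₁ → v i ≠ v (i + 1))

/-- The permutations of the grid produced by the construction with a vertical defect line. -/
structure Vertical {n₁ n₂ : ℕ} (π : Equiv.Perm (Cell n₁ n₂)) : Prop where
  /-- The corners are populated by the four central cells. -/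
  corners : cornerValues π = layer n₁ n₂ 1
  /-- One half of the grid (left or right) is homogeneous, the other half is heterogeneous. -/
  halves : (∀ x, Homogeneous (π x) ↔ x.1.2 ≤ half n₂) ∨
    (∀ x, Homogeneous (π x) ↔ half n₂ < x.1.2)
  /-- Double checkerboard: inside each half, small and large values alternate in both
  coordinates. -/
  checkerboard : ∀ x y : Cell n₁ n₂, l1 x y = 1 → (x.1.2 ≤ half n₂ ↔ y.1.2 ≤ half n₂) →
    (kind (π x)).1 ≠ (kind (π y)).1 ∧ (kind (π x)).2 ≠ (kind (π y)).2
  /-- The boundary is populated layer by layer: an entry is used only if all entries that are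
  closer to the center are used. -/
  boundary_layers : ∀ x ∈ boundaryValues π, ∀ y : Cell n₁ n₂,
    centerDist y < centerDist x → y ∈ boundaryValues π
  /-- The boundary uses equally many entries of each of the four kinds. -/
  boundary_balanced : ∀ κ κ' : Bool × Bool,
    ((boundaryValues π).filter fun x => kind x = κ).card =
      ((boundaryValues π).filter fun x => kind x = κ').card
  /-- Along the defect line there are alternating row defects in all rows, or alternating column
  defects in all rows. -/
  defects : AlternatingDefects π n₁ Prod.fst ∨ AlternatingDefects π n₂ Prod.snd

/-- Transposition of the grid. -/
def transposeCell (n₁ n₂ : ℕ) : Cell n₁ n₂ ≃ Cell n₂ n₁ where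
  toFun x := ⟨x.1.swap, Finset.mem_product.2 (Finset.mem_product.1 x.2).symm⟩
  invFun x := ⟨x.1.swap, Finset.mem_product.2 (Finset.mem_product.1 x.2).symm⟩
  left_inv _ := rfl
  right_inv _ := rfl

/-- The transposed permutation. -/
def transpose {n₁ n₂ : ℕ} (π : Equiv.Perm (Cell n₁ n₂)) : Equiv.Perm (Cell n₂ n₁) :=
  (transposeCell n₁ n₂).permCongr π

/-- The family `𝒫(n₁, n₂)`, for `n₁ ≤ n₂` even: the permutations with a vertical defect line and,
if `n₁ = n₂`, also those with a horizontal defect line, obtained by the transposed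
construction. -/
def family (n₁ n₂ : ℕ) : Set (Equiv.Perm (Cell n₁ n₂)) :=
  {π | Vertical π ∨ (n₁ = n₂ ∧ Vertical (transpose π))}

end Construction

end GridSep

namespace GridSep

open Finset

/-! ### Sums over the edges of the grid -/

section Sums

/-! Route every distance d(π(x), π(y)) through the center: it is the sum of the distances of both
entries to the center, minus a loss. Summed over all edges, an entry counts once per neighbor of its
cell: four times inside, three times on a side, twice in a corner. The interior count is constant,
so (`two_mul_separation`) maximizing f means minimizing the sum of three terms: the weight of the
boundary entries, the weight of the corner entries and the total loss. The first is at least w_k,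
with equality iff the boundary is filled layer by layer (`weight_eq_minWeight_iff`); the second is
least iff the corners hold Λ₁.

For the loss, color each cell by whether its entry is homogeneous. Along a two-colored edge exactly
one coordinate fails to cross its center line, which costs at least 2 in doubled units. The coloring
is a bisection of the grid, and a bisection cuts at least n₁ edges (`IsBisection.le_cut`), with
equality only for a straight line. Hence the upper bound. In the case of equality no edge has any
slack: both coordinates cross inside each half, and the defects along the line have least loss. This
gives the family, up to transposition when n₁ = n₂; balance of the kinds is a consequence.

The three minima must still be attained together. Folding the grid onto a t₁ × t₂ quarter turns the
construction into filling the quarter twice, once for each half. Both fillings put the same quarter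
disk on the boundary, and of two entries facing each other across the line at least one must come
from the first row of the quarter. Enough of that row must therefore stay outside the disk. This is
a quadratic inequality (`quarter_bound`), and it breaks down only for the four excluded squares. -/

theorem sum_Ico_add_succ (c : ℤ → ℤ) {n : ℕ} (hn : 1 ≤ n) :
    ∑ j ∈ Ico (1 : ℤ) n, (c j + c (j + 1)) = 2 * ∑ j ∈ Icc (1 : ℤ) n, c j - c 1 - c n := by
  induction n, hn using Nat.le_induction with
  | base => simp; ring
  | succ n hn ih =>
    have h1 : Ico (1 : ℤ) (n + 1 : ℕ) = insert (n : ℤ) (Ico (1 : ℤ) n) := by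
      ext; simp only [mem_Ico, mem_insert]; omega
    have h2 : Icc (1 : ℤ) (n + 1 : ℕ) = insert ((n : ℤ) + 1) (Icc (1 : ℤ) n) := by
      ext; simp only [mem_Icc, mem_insert]; omega
    rw [h1, h2, sum_insert (by simp), sum_insert (by simp), ih]
    push_cast
    ring

/-- The sum of `G` over the horizontal and the vertical edges of the grid. -/
noncomputable def edgeSum {M : Type*} [AddCommMonoid M] (n₁ n₂ : ℕ) (G : ℤ × ℤ → ℤ × ℤ → M) : M :=
  ∑ i ∈ Icc (1 : ℤ) n₁, ∑ j ∈ Ico (1 : ℤ) n₂, G (i, j) (i, j + 1) +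
    ∑ i ∈ Ico (1 : ℤ) n₁, ∑ j ∈ Icc (1 : ℤ) n₂, G (i, j) (i + 1, j)

theorem Cell.bounds {n₁ n₂ : ℕ} (x : Cell n₁ n₂) :
    1 ≤ x.1.1 ∧ x.1.1 ≤ n₁ ∧ 1 ≤ x.1.2 ∧ x.1.2 ≤ n₂ := by
  have := x.2
  simp only [mem_product, mem_Icc] at this
  tauto

/-- The cell with coordinates `i`, `j`. -/
def mkCell {n₁ n₂ : ℕ} (i j : ℤ) (h : 1 ≤ i ∧ i ≤ n₁ ∧ 1 ≤ j ∧ j ≤ n₂) : Cell n₁ n₂ :=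
  ⟨(i, j), by simp only [mem_product, mem_Icc]; tauto⟩

theorem Cell.ext' {n₁ n₂ : ℕ} {x y : Cell n₁ n₂} (h₁ : x.1.1 = y.1.1) (h₂ : x.1.2 = y.1.2) :
    x = y := Subtype.ext (Prod.ext h₁ h₂)

theorem l1_eq_one_iff (x y : ℤ × ℤ) : l1 x y = 1 ↔
    (x.1 = y.1 ∧ (y.2 = x.2 + 1 ∨ x.2 = y.2 + 1)) ∨
      (x.2 = y.2 ∧ (y.1 = x.1 + 1 ∨ x.1 = y.1 + 1)) := by
  simp only [l1, abs_eq_max_neg]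
  omega

theorem sum_neighborPairs {M : Type*} [AddCommMonoid M] {n₁ n₂ : ℕ}
    (g : Sym2 (Cell n₁ n₂) → M) (G : ℤ × ℤ → ℤ × ℤ → M)
    (hG : ∀ x y : Cell n₁ n₂, g s(x, y) = G x.1 y.1) :
    ∑ e ∈ neighborPairs n₁ n₂, g e = edgeSum n₁ n₂ G := by
  classical
  have hmem : ∀ x y : Cell n₁ n₂, s(x, y) ∈ neighborPairs n₁ n₂ ↔ l1 x.1 y.1 = 1 := by
    intro x y
    rw [neighborPairs, mem_filter, Sym2.map_mk]
    exact and_iff_right (mem_univ _)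
  -- An edge is horizontal exactly when its two ends have the same row, that is, when its image
  -- under the row map is diagonal.
  rw [← sum_filter_add_sum_filter_not (neighborPairs n₁ n₂)
    (fun e => (e.map fun x => x.1.1).IsDiag), edgeSum]
  congr 1
  · rw [← sum_product']
    symm
    refine sum_bij (fun p hp => s(mkCell p.1 p.2 ?_, mkCell p.1 (p.2 + 1) ?_)) ?_ ?_ ?_ ?_
    · simp only [mem_product, mem_Icc, mem_Ico] at hp; omega
    · simp only [mem_product, mem_Icc, mem_Ico] at hp; omega
    · intro p hp
      simp [hmem, mkCell, l1]
    · intro p hp q hq h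
      simp only [Sym2.eq_iff, mkCell, Subtype.mk.injEq, Prod.mk.injEq] at h
      exact Prod.ext (by omega) (by omega)
    · intro e
      induction e using Sym2.ind with
      | _ x y =>
      intro he
      have hx := x.bounds
      have hy := y.bounds
      simp only [mem_filter, hmem, l1_eq_one_iff, Sym2.map_mk, Sym2.mk_isDiag_iff] at he
      rcases he with ⟨⟨h1, h2 | h2⟩ | h1, h3⟩
      · refine ⟨x.1, by simp only [mem_product, mem_Icc, mem_Ico]; omega, ?_⟩
        exact Sym2.eq_iff.2 (Or.inl ⟨rfl, Cell.ext' h1 h2.symm⟩)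
      · refine ⟨y.1, by simp only [mem_product, mem_Icc, mem_Ico]; omega, ?_⟩
        exact Sym2.eq_iff.2 (Or.inr ⟨rfl, Cell.ext' h1.symm h2.symm⟩)
      · omega
    · intro p hp
      rw [hG]
      rfl
  · rw [← sum_product']
    symm
    refine sum_bij (fun p hp => s(mkCell p.1 p.2 ?_, mkCell (p.1 + 1) p.2 ?_)) ?_ ?_ ?_ ?_
    · simp only [mem_product, mem_Icc, mem_Ico] at hp; omega
    · simp only [mem_product, mem_Icc, mem_Ico] at hp; omega
    · intro p hp
      simp [hmem, mkCell, l1]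
    · intro p hp q hq h
      simp only [Sym2.eq_iff, mkCell, Subtype.mk.injEq, Prod.mk.injEq] at h
      exact Prod.ext (by omega) (by omega)
    · intro e
      induction e using Sym2.ind with
      | _ x y =>
      intro he
      have hx := x.bounds
      have hy := y.bounds
      simp only [mem_filter, hmem, l1_eq_one_iff, Sym2.map_mk, Sym2.mk_isDiag_iff] at he
      rcases he with ⟨h1 | ⟨h1, h2 | h2⟩, h3⟩
      · omega
      · refine ⟨x.1, by simp only [mem_product, mem_Icc, mem_Ico]; omega, ?_⟩
        exact Sym2.eq_iff.2 (Or.inl ⟨rfl, Cell.ext' h2.symm h1⟩)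
      · refine ⟨y.1, by simp only [mem_product, mem_Icc, mem_Ico]; omega, ?_⟩
        exact Sym2.eq_iff.2 (Or.inr ⟨rfl, Cell.ext' h2.symm h1.symm⟩)
    · intro p hp
      rw [hG]
      rfl

theorem sum_cell {M : Type*} [AddCommMonoid M] {n₁ n₂ : ℕ} (F : Cell n₁ n₂ → M)
    (F' : ℤ → ℤ → M) (hF : ∀ x, F x = F' x.1.1 x.1.2) :
    ∑ x, F x = ∑ i ∈ Icc (1 : ℤ) n₁, ∑ j ∈ Icc (1 : ℤ) n₂, F' i j := by
  rw [← sum_product' (Icc (1 : ℤ) n₁) (Icc (1 : ℤ) n₂) F',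
    ← sum_coe_sort (Icc (1 : ℤ) n₁ ×ˢ Icc (1 : ℤ) n₂) fun p => F' p.1 p.2]
  exact sum_congr rfl fun x _ => hF x

/-- A cell has four neighbors, less one for each side of the grid on which it lies; a corner lies on
two sides and is subtracted twice. -/
theorem edgeSum_add {n₁ n₂ : ℕ} (h₁ : 1 ≤ n₁) (h₂ : 1 ≤ n₂) (h : ℤ × ℤ → ℤ) :
    edgeSum n₁ n₂ (fun x y => h x + h y) =
      4 * ∑ i ∈ Icc (1 : ℤ) n₁, ∑ j ∈ Icc (1 : ℤ) n₂, h (i, j)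
        - ∑ i ∈ Icc (1 : ℤ) n₁, (h (i, 1) + h (i, n₂))
        - ∑ j ∈ Icc (1 : ℤ) n₂, (h (1, j) + h (n₁, j)) := by
  have e1 : ∀ i, ∑ j ∈ Ico (1 : ℤ) n₂, (h (i, j) + h (i, j + 1)) =
      2 * ∑ j ∈ Icc (1 : ℤ) n₂, h (i, j) - h (i, 1) - h (i, n₂) :=
    fun i => sum_Ico_add_succ (fun j => h (i, j)) h₂
  have e2 : ∀ j, ∑ i ∈ Ico (1 : ℤ) n₁, (h (i, j) + h (i + 1, j)) =
      2 * ∑ i ∈ Icc (1 : ℤ) n₁, h (i, j) - h (1, j) - h (n₁, j) :=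
    fun j => sum_Ico_add_succ (fun i => h (i, j)) h₁
  have e3 : ∑ j ∈ Icc (1 : ℤ) n₂, ∑ i ∈ Icc (1 : ℤ) n₁, h (i, j) =
    ∑ i ∈ Icc (1 : ℤ) n₁, ∑ j ∈ Icc (1 : ℤ) n₂, h (i, j) := sum_comm
  rw [edgeSum, sum_comm (s := Ico (1 : ℤ) n₁)]
  simp only [e1, e2, sum_sub_distrib, sum_add_distrib, ← mul_sum]
  rw [e3]
  ring

theorem edgeSum_congr {M : Type*} [AddCommMonoid M] {n₁ n₂ : ℕ} {F G : ℤ × ℤ → ℤ × ℤ → M}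
    (h : ∀ x y : Cell n₁ n₂, l1 x.1 y.1 = 1 → F x.1 y.1 = G x.1 y.1) :
    edgeSum n₁ n₂ F = edgeSum n₁ n₂ G := by
  unfold edgeSum
  congr 1
  · refine sum_congr rfl fun i hi => sum_congr rfl fun j hj => ?_
    simp only [mem_Icc, mem_Ico] at hi hj
    exact h (mkCell i j (by omega)) (mkCell i (j + 1) (by omega)) (by simp [mkCell, l1])
  · refine sum_congr rfl fun i hi => sum_congr rfl fun j hj => ?_
    simp only [mem_Icc, mem_Ico] at hi hj
    exact h (mkCell i j (by omega)) (mkCell (i + 1) j (by omega)) (by simp [mkCell, l1])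

end Sums

/-! ### The identity between separation, boundary, corners and loss -/

section Identity

/-- Twice the distance of `a` to the center of `{1,…,n}`. -/
noncomputable def offset (n : ℕ) (a : ℤ) : ℤ := |2 * a - n - 1|

/-- Twice the distance of a cell to the center of the grid. -/
noncomputable def cellOffset {n₁ n₂ : ℕ} (x : Cell n₁ n₂) : ℤ := offset n₁ x.1.1 + offset n₂ x.1.2

/-- The loss in the triangle inequality through the center of `{1,…,n}`, doubled. -/
noncomputable def loss (n : ℕ) (a b : ℤ) : ℤ := offset n a + offset n b - 2 * |a - b|

/-- The loss in both coordinates together. -/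
noncomputable def pairLoss (n₁ n₂ : ℕ) (p q : ℤ × ℤ) : ℤ := loss n₁ p.1 q.1 + loss n₂ p.2 q.2

/-- `π` as a function on `ℤ × ℤ`. -/
noncomputable def entry {n₁ n₂ : ℕ} (π : Equiv.Perm (Cell n₁ n₂)) (p : ℤ × ℤ) : ℤ × ℤ :=
  if h : p ∈ Icc (1 : ℤ) n₁ ×ˢ Icc (1 : ℤ) n₂ then (π ⟨p, h⟩).1 else 0

/-- The sum of the losses over all edges. -/
noncomputable def totalLoss {n₁ n₂ : ℕ} (π : Equiv.Perm (Cell n₁ n₂)) : ℤ :=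
  edgeSum n₁ n₂ fun x y => pairLoss n₁ n₂ (entry π x) (entry π y)

theorem entry_coe {n₁ n₂ : ℕ} (π : Equiv.Perm (Cell n₁ n₂)) (x : Cell n₁ n₂) :
    entry π x.1 = (π x).1 := by
  simp only [entry, x.2, dite_true]

/-- The corners of the grid. -/
noncomputable def cornerCells (n₁ n₂ : ℕ) : Finset (Cell n₁ n₂) :=
  {x | (x.1.1 = 1 ∨ x.1.1 = n₁) ∧ (x.1.2 = 1 ∨ x.1.2 = n₂)}

/-- The boundary of the grid. -/
noncomputable def boundaryCells (n₁ n₂ : ℕ) : Finset (Cell n₁ n₂) :=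
  {x | x.1.1 = 1 ∨ x.1.1 = n₁ ∨ x.1.2 = 1 ∨ x.1.2 = n₂}

theorem cornerValues_eq {n₁ n₂ : ℕ} (π : Equiv.Perm (Cell n₁ n₂)) :
    cornerValues π = (cornerCells n₁ n₂).image π := rfl

theorem boundaryValues_eq {n₁ n₂ : ℕ} (π : Equiv.Perm (Cell n₁ n₂)) :
    boundaryValues π = (boundaryCells n₁ n₂).image π := rfl

theorem sum_Icc_abs (t : ℤ) (k : ℕ) :
    ∑ a ∈ Icc (t + 1 - k) (t + k), |2 * a - 2 * t - 1| = 2 * (k : ℤ) ^ 2 := by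
  induction k with
  | zero => simp
  | succ k ih =>
    have h : Icc (t + 1 - (k + 1 : ℕ)) (t + (k + 1 : ℕ)) =
        insert (t - k) (insert (t + k + 1) (Icc (t + 1 - k) (t + k))) := by
      ext; simp only [mem_insert, mem_Icc]; omega
    rw [h, sum_insert, sum_insert, ih]
    · have e1 : |2 * (t - k) - 2 * t - 1| = 2 * (k : ℤ) + 1 := by
        rw [abs_of_nonpos (by omega)]; ring
      have e2 : |2 * (t + k + 1) - 2 * t - 1| = 2 * (k : ℤ) + 1 := by
        rw [abs_of_nonneg (by omega)]; ring
      rw [e1, e2]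
      push_cast
      ring
    · simp only [mem_Icc]; omega
    · simp only [mem_insert, mem_Icc]; omega

theorem two_mul_sum_offset {n : ℕ} (hn : Even n) :
    2 * ∑ a ∈ Icc (1 : ℤ) n, offset n a = (n : ℤ) ^ 2 := by
  obtain ⟨t, rfl⟩ := hn
  have h := sum_Icc_abs t t
  have e : Icc (t + 1 - t : ℤ) (t + t) = Icc (1 : ℤ) (t + t : ℕ) := by
    push_cast; congr 1; ring
  rw [e] at h
  have e2 : ∑ a ∈ Icc (1 : ℤ) (t + t : ℕ), offset (t + t) a =
      ∑ a ∈ Icc (1 : ℤ) (t + t : ℕ), |2 * a - 2 * t - 1| := by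
    refine sum_congr rfl fun a _ => ?_
    rw [offset]; congr 1; push_cast; ring
  rw [e2, h]; push_cast; ring

theorem two_mul_sum_cellOffset {n₁ n₂ : ℕ} (h₁ : Even n₁) (h₂ : Even n₂) :
    2 * ∑ x : Cell n₁ n₂, cellOffset x = n₁ * n₂ * (n₁ + n₂ : ℤ) := by
  rw [sum_cell cellOffset (fun i j => offset n₁ i + offset n₂ j) fun x => rfl]
  have e1 := two_mul_sum_offset h₁
  have e2 := two_mul_sum_offset h₂
  simp only [sum_add_distrib, sum_const, Int.card_Icc, add_sub_cancel_right, Int.toNat_natCast,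
    nsmul_eq_mul, ← mul_sum]
  linear_combination (n₂ : ℤ) * e1 + n₁ * e2

/-- Inclusion–exclusion: the boundary is the union, and the set of corners the intersection, of the
outer rows with the outer columns. -/
theorem sum_boundary_add_sum_corner {n₁ n₂ : ℕ} (h₁ : 2 ≤ n₁) (h₂ : 2 ≤ n₂)
    (F : Cell n₁ n₂ → ℤ) (F' : ℤ × ℤ → ℤ) (hF : ∀ x, F x = F' x.1) :
    ∑ x ∈ boundaryCells n₁ n₂, F x + ∑ x ∈ cornerCells n₁ n₂, F x =
      ∑ i ∈ Icc (1 : ℤ) n₁, (F' (i, 1) + F' (i, n₂)) +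
        ∑ j ∈ Icc (1 : ℤ) n₂, (F' (1, j) + F' (n₁, j)) := by
  classical
  have hb : boundaryCells n₁ n₂ =
      (univ.filter fun x : Cell n₁ n₂ => x.1.1 = 1 ∨ x.1.1 = n₁) ∪
        univ.filter fun x : Cell n₁ n₂ => x.1.2 = 1 ∨ x.1.2 = n₂ := by
    ext; simp only [boundaryCells, mem_union, mem_filter, mem_univ, true_and]; tauto
  have hc : cornerCells n₁ n₂ =
      (univ.filter fun x : Cell n₁ n₂ => x.1.1 = 1 ∨ x.1.1 = n₁) ∩
        univ.filter fun x : Cell n₁ n₂ => x.1.2 = 1 ∨ x.1.2 = n₂ := by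
    ext; simp only [cornerCells, mem_inter, mem_filter, mem_univ, true_and]
  rw [hb, hc, sum_union_inter, sum_filter, sum_filter,
    sum_cell (fun x => if x.1.1 = 1 ∨ x.1.1 = n₁ then F x else 0)
      (fun i j => if i = 1 ∨ i = n₁ then F' (i, j) else 0) (fun x => by rw [hF]),
    sum_cell (fun x => if x.1.2 = 1 ∨ x.1.2 = n₂ then F x else 0)
      (fun i j => if j = 1 ∨ j = n₂ then F' (i, j) else 0) (fun x => by rw [hF]), add_comm]
  have key : ∀ (n : ℕ) (c : ℤ → ℤ), 2 ≤ n →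
      ∑ j ∈ Icc (1 : ℤ) n, (if j = 1 ∨ j = n then c j else 0) = c 1 + c n := by
    intro n c hn
    rw [← sum_filter]
    have : (Icc (1 : ℤ) n).filter (fun j : ℤ => j = 1 ∨ j = n) = {1, (n : ℤ)} := by
      ext; simp only [mem_filter, mem_Icc, mem_insert, mem_singleton]; omega
    rw [this, sum_pair (by omega)]
  congr 1
  · exact sum_congr rfl fun i _ => key n₂ (fun j => F' (i, j)) h₂
  · rw [sum_comm]
    exact sum_congr rfl fun j _ => key n₁ (fun i => F' (i, j)) h₁

theorem edgeSum_add_edgeSum {n₁ n₂ : ℕ} (F G : ℤ × ℤ → ℤ × ℤ → ℤ) :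
    edgeSum n₁ n₂ (fun x y => F x y + G x y) = edgeSum n₁ n₂ F + edgeSum n₁ n₂ G := by
  simp only [edgeSum, sum_add_distrib]
  ring

theorem mul_edgeSum {n₁ n₂ : ℕ} (c : ℤ) (F : ℤ × ℤ → ℤ × ℤ → ℤ) :
    c * edgeSum n₁ n₂ F = edgeSum n₁ n₂ fun x y => c * F x y := by
  simp only [edgeSum, mul_add, mul_sum]

theorem separation_eq_edgeSum {n₁ n₂ : ℕ} (π : Equiv.Perm (Cell n₁ n₂)) :
    separation π = edgeSum n₁ n₂ fun x y => l1 (entry π x) (entry π y) := by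
  refine sum_neighborPairs _ _ fun x y => ?_
  rw [entry_coe, entry_coe]
  rfl

/-- The basic identity. Since π is a bijection, the sum of all offsets does not depend on it, so
only the missing degrees at the boundary and the loss distinguish one permutation from another.
Doubling keeps everything in the integers. -/
theorem two_mul_separation {n₁ n₂ : ℕ} (h₁ : Even n₁) (h₂ : Even n₂) (p₁ : 0 < n₁) (p₂ : 0 < n₂)
    (π : Equiv.Perm (Cell n₁ n₂)) :
    2 * separation π + ∑ x ∈ boundaryCells n₁ n₂, cellOffset (π x) +
      ∑ x ∈ cornerCells n₁ n₂, cellOffset (π x) + totalLoss π =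
        2 * (n₁ * n₂ * (n₁ + n₂ : ℤ)) := by
  obtain ⟨k₁, hk₁⟩ := id h₁
  obtain ⟨k₂, hk₂⟩ := id h₂
  let H : ℤ × ℤ → ℤ := fun p => offset n₁ (entry π p).1 + offset n₂ (entry π p).2
  have hH : ∀ x, cellOffset (π x) = H x.1 := by
    intro x; simp only [cellOffset, H, entry_coe]
  have s2 : 2 * separation π + totalLoss π = edgeSum n₁ n₂ fun x y => H x + H y := by
    rw [separation_eq_edgeSum, totalLoss, mul_edgeSum, ← edgeSum_add_edgeSum]
    refine edgeSum_congr fun x y _ => ?_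
    simp only [l1, pairLoss, loss, H]
    ring
  have s3 := sum_boundary_add_sum_corner (by omega) (by omega) (fun x => cellOffset (π x)) H hH
  have s4 := edgeSum_add (n₁ := n₁) (n₂ := n₂) (by omega) (by omega) H
  have s5 : ∑ i ∈ Icc (1 : ℤ) n₁, ∑ j ∈ Icc (1 : ℤ) n₂, H (i, j) =
      ∑ x : Cell n₁ n₂, cellOffset x := by
    rw [← Equiv.sum_comp π cellOffset]
    exact (sum_cell (fun x => cellOffset (π x)) (fun i j => H (i, j)) hH).symm
  have s6 := two_mul_sum_cellOffset h₁ h₂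
  rw [s5] at s4
  linarith

theorem two_mul_centerDist {n₁ n₂ : ℕ} (x : Cell n₁ n₂) : 2 * centerDist x = cellOffset x := by
  have h : ∀ (n : ℕ) (a : ℤ), 2 * |(a : ℝ) - ((n : ℝ) + 1) / 2| = (offset n a : ℤ) := by
    intro n a
    rw [offset]
    push_cast
    rw [← abs_of_pos (two_pos : (0 : ℝ) < 2), ← abs_mul, abs_of_pos (two_pos : (0 : ℝ) < 2)]
    congr 1; ring
  rw [centerDist, mul_add, h, h, cellOffset]
  push_cast
  rfl

theorem centerDist_lt_iff {n₁ n₂ : ℕ} (x y : Cell n₁ n₂) :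
    centerDist x < centerDist y ↔ cellOffset x < cellOffset y := by
  rw [← Int.cast_lt (R := ℝ), ← two_mul_centerDist, ← two_mul_centerDist]
  constructor <;> intro h <;> linarith

theorem two_mul_weight_image {n₁ n₂ : ℕ} (A : Finset (Cell n₁ n₂)) (π : Equiv.Perm (Cell n₁ n₂)) :
    2 * weight (A.image π) = (∑ x ∈ A, cellOffset (π x) : ℤ) := by
  rw [weight, sum_image fun x _ y _ h => π.injective h, mul_sum]
  push_cast
  exact sum_congr rfl fun x _ => two_mul_centerDist _

end Identity

/-! ### Sets of least weight and the corner entries -/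

section Weights

theorem minWeight_le_weight {n₁ n₂ : ℕ} (A : Finset (Cell n₁ n₂)) :
    minWeight n₁ n₂ A.card ≤ weight A := by
  refine (isLeast_minWeight ?_).2 ⟨A, rfl, rfl⟩
  simpa using card_le_univ A

/-- The sets of least weight are those that are filled layer by layer. -/
theorem weight_eq_minWeight_iff {n₁ n₂ : ℕ} (A : Finset (Cell n₁ n₂)) :
    weight A = minWeight n₁ n₂ A.card ↔
      ∀ x ∈ A, ∀ y, centerDist y < centerDist x → y ∈ A := by
  classical
  constructor
  · intro h x hx y hxy
    by_contra hy
    have hy' : y ∉ A.erase x := fun h => hy (mem_of_mem_erase h)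
    have h1 := minWeight_le_weight (insert y (A.erase x))
    rw [card_insert_of_notMem hy', card_erase_add_one hx, ← h, weight, weight,
      sum_insert hy', ← add_sum_erase A _ hx] at h1
    linarith
  · intro h
    refine le_antisymm ?_ (minWeight_le_weight A)
    obtain ⟨B, hB, hw⟩ := (isLeast_minWeight (n₁ := n₁) (n₂ := n₂) (k := A.card)
      (by simpa using card_le_univ A)).1
    rw [hw, weight, weight, ← sum_sdiff_le_sum_sdiff]
    rcases (A \ B).eq_empty_or_nonempty with he | hne
    · rw [he, sum_empty]
      exact sum_nonneg fun x _ => add_nonneg (abs_nonneg _) (abs_nonneg _)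
    -- The farthest cell `m` of `A \ B` separates the two differences: a cell of `B \ A` closer than
    -- `m` would already belong to `A`.
    · obtain ⟨m, hm, hmax⟩ := exists_max_image (A \ B) centerDist hne
      rw [mem_sdiff] at hm
      have hcard : (A \ B).card = (B \ A).card := card_sdiff_comm hB.symm
      calc ∑ x ∈ A \ B, centerDist x ≤ (A \ B).card • centerDist m :=
            sum_le_card_nsmul _ _ _ hmax
        _ = (B \ A).card • centerDist m := by rw [hcard]
        _ ≤ ∑ x ∈ B \ A, centerDist x := by
            refine card_nsmul_le_sum _ _ _ fun x hx => ?_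
            rw [mem_sdiff] at hx
            by_contra hlt
            exact hx.2 (h m hm.1 x (not_le.1 hlt))

theorem offset_pos {n : ℕ} (hn : Even n) (a : ℤ) : 1 ≤ offset n a := by
  obtain ⟨t, rfl⟩ := hn
  simp only [offset, abs_eq_max_neg]
  omega

theorem offset_eq_one_iff {n : ℕ} (hn : Even n) (a : ℤ) :
    offset n a = 1 ↔ a = half n ∨ a = half n + 1 := by
  obtain ⟨t, rfl⟩ := hn
  simp only [offset, half, abs_eq_max_neg]
  omega

theorem exists_cellOffset_eq {n₁ n₂ : ℕ} (h₁ : Even n₁) (h₂ : Even n₂) (x : Cell n₁ n₂) :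
    ∃ d : ℕ, 1 ≤ d ∧ centerDist x = d ∧ cellOffset x = 2 * d := by
  have h : ∃ d : ℕ, 1 ≤ d ∧ cellOffset x = 2 * d := by
    obtain ⟨t, rfl⟩ := h₁
    obtain ⟨s, rfl⟩ := h₂
    refine ⟨(cellOffset x / 2).toNat, ?_, ?_⟩ <;>
    · simp only [cellOffset, offset, abs_eq_max_neg]
      omega
  obtain ⟨d, hd, hx⟩ := h
  refine ⟨d, hd, ?_, hx⟩
  have := two_mul_centerDist x
  rw [hx] at this
  push_cast at this
  linarith

theorem mem_layer {n₁ n₂ i : ℕ} (x : Cell n₁ n₂) : x ∈ layer n₁ n₂ i ↔ centerDist x = i := by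
  simp [layer]

/-- The weight of a set in terms of its intersections with small disks. -/
theorem minWeight_eq {n₁ n₂ : ℕ} (h₁ : Even n₁) (h₂ : Even n₂) {k r : ℕ} (hk : k ≤ n₁ * n₂)
    (hr : ∑ i ∈ Icc 1 r, (layer n₁ n₂ i).card ≤ k)
    (hr' : k ≤ ∑ i ∈ Icc 1 (r + 1), (layer n₁ n₂ i).card) :
    minWeight n₁ n₂ k = ∑ i ∈ Icc 1 r, (i : ℝ) * (layer n₁ n₂ i).card +
      ((r : ℝ) + 1) * (k - ∑ i ∈ Icc 1 r, ((layer n₁ n₂ i).card : ℝ)) := by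
  classical
  let D : ℕ → Finset (Cell n₁ n₂) := fun r => (Icc 1 r).biUnion (layer n₁ n₂)
  have hdisj : ∀ r, ((Icc 1 r : Finset ℕ) : Set ℕ).PairwiseDisjoint (layer n₁ n₂) := by
    intro r i _ j _ hij
    refine disjoint_left.2 fun x hx hx' => hij ?_
    rw [mem_layer] at hx hx'
    exact_mod_cast hx.symm.trans hx'
  have hcard : ∀ r, (D r).card = ∑ i ∈ Icc 1 r, (layer n₁ n₂ i).card :=
    fun r => card_biUnion (hdisj r)
  have hmem : ∀ r x, x ∈ D r ↔ centerDist x ≤ r := by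
    intro r x
    obtain ⟨d, hd, hx, -⟩ := exists_cellOffset_eq h₁ h₂ x
    simp only [D, mem_biUnion, mem_layer, mem_Icc, hx, Nat.cast_inj, Nat.cast_le]
    exact ⟨fun ⟨i, hi, h⟩ => h ▸ hi.2, fun h => ⟨d, ⟨hd, h⟩, rfl⟩⟩
  have hgt : ∀ r x, x ∉ D r → (r : ℝ) + 1 ≤ centerDist x := by
    intro r x
    rw [hmem]
    obtain ⟨d, hd, hx, -⟩ := exists_cellOffset_eq h₁ h₂ x
    rw [hx]
    intro h
    have : r + 1 ≤ d := by
      have : ¬ d ≤ r := fun h' => h (by exact_mod_cast h')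
      omega
    exact_mod_cast this
  have hw : weight (D r) = ∑ i ∈ Icc 1 r, (i : ℝ) * (layer n₁ n₂ i).card := by
    rw [weight, sum_biUnion (hdisj r)]
    refine sum_congr rfl fun i _ => ?_
    rw [sum_congr rfl fun x hx => (mem_layer x).1 hx, sum_const, nsmul_eq_mul, mul_comm]
  rw [← hw, ← Nat.cast_sum, ← hcard]
  refine le_antisymm ?_ ?_
  · have hsub : D r ⊆ D (r + 1) := by
      intro x hx
      rw [hmem] at hx ⊢
      push_cast
      linarith
    obtain ⟨A, hA, hA', hAk⟩ := exists_subsuperset_card_eq hsub (hcard r ▸ hr) (hcard _ ▸ hr')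
    have h1 := minWeight_le_weight A
    rw [hAk] at h1
    refine h1.trans_eq ?_
    rw [weight, ← sum_sdiff hA, sum_congr rfl (g := fun _ => (r : ℝ) + 1), sum_const,
      card_sdiff_of_subset hA, hAk, nsmul_eq_mul, Nat.cast_sub (hcard r ▸ hr), weight]
    · ring
    · intro x hx
      rw [mem_sdiff] at hx
      refine le_antisymm ?_ (hgt r x hx.2)
      have := (hmem _ x).1 (hA' hx.1)
      push_cast at this
      exact this
  · obtain ⟨A, hA, hAw⟩ := (isLeast_minWeight hk).1
    rw [hAw]
    -- With distances shifted by r + 1, the disk `D r` has only non-positive terms and its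
    -- complement only non-negative ones, so `D r` is optimal among sets of all sizes.
    have h1 : ∑ x ∈ D r, (centerDist x - (r + 1)) ≤ ∑ x ∈ A, (centerDist x - (r + 1)) := by
      rw [← sum_sdiff_le_sum_sdiff]
      refine (sum_nonpos fun x hx => ?_).trans (sum_nonneg fun x hx => ?_)
      · have := (hmem _ x).1 (mem_sdiff.1 hx).1
        linarith
      · have := hgt r x (mem_sdiff.1 hx).2
        linarith
    rw [sum_sub_distrib, sum_sub_distrib, sum_const, sum_const, hA, nsmul_eq_mul,
      nsmul_eq_mul] at h1
    rw [weight, weight]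
    linarith

theorem card_cornerCells {n₁ n₂ : ℕ} (h₁ : 2 ≤ n₁) (h₂ : 2 ≤ n₂) :
    (cornerCells n₁ n₂).card = 4 := by
  have h : (cornerCells n₁ n₂).map (Function.Embedding.subtype _) =
      ({1, (n₁ : ℤ)} : Finset ℤ) ×ˢ ({1, (n₂ : ℤ)} : Finset ℤ) := by
    ext ⟨i, j⟩
    simp only [cornerCells, mem_map, mem_filter, mem_univ, true_and, mem_product, mem_insert,
      mem_singleton, Function.Embedding.subtype_apply]
    constructor
    · rintro ⟨x, hx, h⟩; simpa only [h] using hx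
    · intro hx; exact ⟨mkCell i j (by omega), hx, rfl⟩
  rw [← card_map, h, card_product, card_pair (by omega), card_pair (by omega)]

theorem card_layer_one {n₁ n₂ : ℕ} (h₁ : Even n₁) (h₂ : Even n₂) (p₁ : 2 ≤ n₁) (p₂ : 2 ≤ n₂) :
    (layer n₁ n₂ 1).card = 4 := by
  have h : (layer n₁ n₂ 1).map (Function.Embedding.subtype _) =
      ({half n₁, half n₁ + 1} : Finset ℤ) ×ˢ ({half n₂, half n₂ + 1} : Finset ℤ) := by
    have key : ∀ x : Cell n₁ n₂, x ∈ layer n₁ n₂ 1 ↔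
        (x.1.1 = half n₁ ∨ x.1.1 = half n₁ + 1) ∧ (x.1.2 = half n₂ ∨ x.1.2 = half n₂ + 1) := by
      intro x
      rw [← offset_eq_one_iff h₁, ← offset_eq_one_iff h₂, mem_layer]
      have e := two_mul_centerDist x
      have q₁ := offset_pos h₁ x.1.1
      have q₂ := offset_pos h₂ x.1.2
      constructor
      · intro h
        rw [h] at e
        have e' : (2 : ℤ) = cellOffset x := by exact_mod_cast e
        rw [cellOffset] at e'
        omega
      · rintro ⟨a, b⟩
        rw [cellOffset, a, b] at e
        push_cast at e ⊢
        linarith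
    ext ⟨i, j⟩
    simp only [mem_map, mem_product, mem_insert, mem_singleton,
      Function.Embedding.subtype_apply, key]
    constructor
    · rintro ⟨x, hx, h⟩; simpa only [h] using hx
    · intro hx
      refine ⟨mkCell i j ?_, hx, rfl⟩
      obtain ⟨t, rfl⟩ := h₁
      obtain ⟨s, rfl⟩ := h₂
      simp only [half] at hx
      omega
  rw [← card_map, h, card_product, card_pair (by omega), card_pair (by omega)]

theorem card_boundaryCells {n₁ n₂ : ℕ} (h₁ : 2 ≤ n₁) (h₂ : 2 ≤ n₂) :
    (boundaryCells n₁ n₂).card = 2 * n₁ + 2 * n₂ - 4 := by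
  have h := sum_boundary_add_sum_corner h₁ h₂ (fun _ => 1) (fun _ => 1) fun _ => rfl
  simp only [sum_const, card_cornerCells h₁ h₂, Int.card_Icc, add_sub_cancel_right,
    Int.toNat_natCast, nsmul_eq_mul, mul_one] at h
  omega

theorem eight_le_sum_corner {n₁ n₂ : ℕ} (h₁ : Even n₁) (h₂ : Even n₂) (p₁ : 2 ≤ n₁) (p₂ : 2 ≤ n₂)
    (π : Equiv.Perm (Cell n₁ n₂)) : 8 ≤ ∑ x ∈ cornerCells n₁ n₂, cellOffset (π x) := by
  have h := card_nsmul_le_sum (cornerCells n₁ n₂) (fun x => cellOffset (π x)) 2 fun x _ => by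
    obtain ⟨d, hd, -, hx⟩ := exists_cellOffset_eq h₁ h₂ (π x)
    omega
  rw [card_cornerCells p₁ p₂] at h
  simpa using h

theorem sum_corner_eq_iff {n₁ n₂ : ℕ} (h₁ : Even n₁) (h₂ : Even n₂) (p₁ : 2 ≤ n₁) (p₂ : 2 ≤ n₂)
    (π : Equiv.Perm (Cell n₁ n₂)) :
    ∑ x ∈ cornerCells n₁ n₂, cellOffset (π x) = 8 ↔ cornerValues π = layer n₁ n₂ 1 := by
  have hoff : ∀ x : Cell n₁ n₂, x ∈ layer n₁ n₂ 1 ↔ cellOffset x = 2 := by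
    intro x
    obtain ⟨d, hd, hx, hx'⟩ := exists_cellOffset_eq h₁ h₂ x
    rw [mem_layer, hx, hx', Nat.cast_inj]
    omega
  have hs : ∑ x ∈ cornerCells n₁ n₂, (2 : ℤ) = 8 := by
    rw [sum_const, card_cornerCells p₁ p₂]; rfl
  have hle : ∀ x ∈ cornerCells n₁ n₂, 2 ≤ cellOffset (π x) := fun x _ => by
    obtain ⟨d, hd, -, hx⟩ := exists_cellOffset_eq h₁ h₂ (π x)
    omega
  rw [← hs, eq_comm, sum_eq_sum_iff_of_le hle, cornerValues_eq]
  constructor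
  · intro h
    refine eq_of_subset_of_card_le ?_ ?_
    · intro y hy
      obtain ⟨x, hx, rfl⟩ := mem_image.1 hy
      exact (hoff _).2 (h x hx).symm
    · rw [card_layer_one h₁ h₂ p₁ p₂, card_image_of_injective _ π.injective,
        card_cornerCells p₁ p₂]
  · intro h x hx
    exact ((hoff _).1 (h ▸ mem_image_of_mem π hx)).symm

end Weights

/-! ### Bisections of a grid cut at least as many edges as its shorter side -/

section Bisection

/-- The number of changes in the sequence `c 1, …, c n`. -/
noncomputable def changes (c : ℤ → Bool) (n : ℕ) : ℤ :=
  ∑ j ∈ Ico (1 : ℤ) n, if c j = c (j + 1) then 0 else 1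

theorem changes_nonneg (c : ℤ → Bool) (n : ℕ) : 0 ≤ changes c n :=
  sum_nonneg fun _ _ => by split_ifs <;> norm_num

theorem eq_of_forall_succ_eq {c : ℤ → Bool} {a b : ℤ} (hab : a ≤ b)
    (h : ∀ j, a ≤ j → j < b → c j = c (j + 1)) : c a = c b := by
  induction b, hab using Int.leInduction with
  | base => rfl
  | succ b hb ih => exact (ih fun j h1 h2 => h j h1 (by omega)).trans (h b hb (by omega))

theorem eq_of_changes_eq_zero {c : ℤ → Bool} {n : ℕ} (h : changes c n = 0) {i j : ℤ}
    (hi : 1 ≤ i) (hi' : i ≤ n) (hj : 1 ≤ j) (hj' : j ≤ n) : c i = c j := by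
  rw [changes, sum_eq_zero_iff_of_nonneg fun _ _ => by split_ifs <;> norm_num] at h
  have key : ∀ k : ℤ, 1 ≤ k → k ≤ n → c 1 = c k := fun k hk hk' =>
    eq_of_forall_succ_eq hk fun m h1 h2 => by
      by_contra hne
      simpa [hne] using h m (mem_Ico.2 ⟨h1, by omega⟩)
  rw [← key i hi hi', ← key j hj hj']

theorem eq_half_of_changes_eq_one {c : ℤ → Bool} {n : ℕ} (h : changes c n = 1)
    (hc : 2 * ((Icc (1 : ℤ) n).filter fun j => c j = true).card = n) :
    (∀ j : ℤ, 1 ≤ j → j ≤ n → (c j = true ↔ j ≤ half n)) ∨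
      (∀ j : ℤ, 1 ≤ j → j ≤ n → (c j = true ↔ half n < j)) := by
  have hex : ∃ m ∈ Ico (1 : ℤ) n, c m ≠ c (m + 1) := by
    by_contra! hne
    rw [changes, sum_congr rfl fun j hj => if_pos (hne j hj)] at h
    simp at h
  obtain ⟨m, hm, hne⟩ := hex
  have hrest : ∀ j ∈ Ico (1 : ℤ) n, j ≠ m → c j = c (j + 1) := by
    rw [changes, ← add_sum_erase _ _ hm, if_neg hne, add_eq_left,
      sum_eq_zero_iff_of_nonneg fun _ _ => by split_ifs <;> norm_num] at h
    intro j hj hjm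
    by_contra hne
    simpa [hne] using h j (mem_erase.2 ⟨hjm, hj⟩)
  simp only [mem_Ico] at hm hrest
  have hl : ∀ j : ℤ, 1 ≤ j → j ≤ m → c j = c m := fun j h1 h2 =>
    eq_of_forall_succ_eq h2 fun k h3 h4 => hrest k (by omega) (by omega)
  have hr : ∀ j, m + 1 ≤ j → j ≤ n → c j = c (m + 1) := fun j h1 h2 =>
    (eq_of_forall_succ_eq h1 fun k h3 h4 => hrest k (by omega) (by omega)).symm
  cases hcm : c m with
  | true =>
    have hcm' : c (m + 1) = false := by
      rw [hcm] at hne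
      cases h : c (m + 1) <;> simp_all
    have key : ∀ j : ℤ, 1 ≤ j → j ≤ n → (c j = true ↔ j ≤ m) := by
      intro j h1 h2
      rcases le_or_gt j m with h3 | h3
      · rw [hl j h1 h3, hcm]; simp [h3]
      · rw [hr j h3 h2, hcm']; simp [h3]
    have : (Icc (1 : ℤ) n).filter (fun j => c j = true) = Icc 1 m := by
      ext j
      simp only [mem_filter, mem_Icc]
      constructor
      · rintro ⟨⟨h1, h2⟩, h3⟩; exact ⟨h1, (key j h1 h2).1 h3⟩
      · rintro ⟨h1, h2⟩; exact ⟨⟨h1, by omega⟩, (key j h1 (by omega)).2 h2⟩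
    rw [this, Int.card_Icc] at hc
    left
    intro j h1 h2
    rw [key j h1 h2, half]
    omega
  | false =>
    have hcm' : c (m + 1) = true := by
      rw [hcm] at hne
      cases h : c (m + 1) <;> simp_all
    have key : ∀ j : ℤ, 1 ≤ j → j ≤ n → (c j = true ↔ m < j) := by
      intro j h1 h2
      rcases le_or_gt j m with h3 | h3
      · rw [hl j h1 h3, hcm]; simp [h3]
      · rw [hr j h3 h2, hcm']; simp [h3]
    have : (Icc (1 : ℤ) n).filter (fun j => c j = true) = Icc (m + 1) n := by
      ext j
      simp only [mem_filter, mem_Icc]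
      constructor
      · rintro ⟨⟨h1, h2⟩, h3⟩; exact ⟨(key j h1 h2).1 h3, h2⟩
      · rintro ⟨h1, h2⟩; exact ⟨⟨by omega, h2⟩, (key j (by omega) h2).2 h1⟩
    rw [this, Int.card_Icc] at hc
    right
    intro j h1 h2
    rw [key j h1 h2, half]
    omega

/-- The number of horizontal edges between the two classes of a 2-coloring of the grid. -/
noncomputable def rowCut (n₁ n₂ : ℕ) (h : ℤ → ℤ → Bool) : ℤ :=
  ∑ i ∈ Icc (1 : ℤ) n₁, changes (h i) n₂

theorem rowCut_nonneg (n₁ n₂ : ℕ) (h : ℤ → ℤ → Bool) : 0 ≤ rowCut n₁ n₂ h :=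
  sum_nonneg fun _ _ => changes_nonneg _ _

theorem card_le_rowCut (n₁ n₂ : ℕ) (h : ℤ → ℤ → Bool) :
    (((Icc (1 : ℤ) n₁).filter fun i => changes (h i) n₂ ≠ 0).card : ℤ) ≤ rowCut n₁ n₂ h := by
  rw [rowCut, ← sum_filter_add_sum_filter_not (Icc (1 : ℤ) n₁) fun i => changes (h i) n₂ ≠ 0]
  have h1 := card_nsmul_le_sum ((Icc (1 : ℤ) n₁).filter fun i => changes (h i) n₂ ≠ 0)
    (fun i => changes (h i) n₂) 1 fun i hi => by
      have := changes_nonneg (h i) n₂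
      have := (mem_filter.1 hi).2
      omega
  have h2 : 0 ≤ ∑ i ∈ (Icc (1 : ℤ) n₁).filter (fun i => ¬ changes (h i) n₂ ≠ 0),
    changes (h i) n₂ := sum_nonneg fun _ _ => changes_nonneg _ _
  rw [nsmul_eq_mul, mul_one] at h1
  omega

/-- A color class of half the size of the grid. -/
def IsBisection (n₁ n₂ : ℕ) (h : ℤ → ℤ → Bool) : Prop :=
  2 * ((Icc (1 : ℤ) n₁ ×ˢ Icc (1 : ℤ) n₂).filter fun p => h p.1 p.2 = true).card = n₁ * n₂

theorem IsBisection.card_filter_ne {n₁ n₂ : ℕ} {h : ℤ → ℤ → Bool} (hb : IsBisection n₁ n₂ h)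
    (b : Bool) :
    2 * ((Icc (1 : ℤ) n₁ ×ˢ Icc (1 : ℤ) n₂).filter fun p => h p.1 p.2 ≠ b).card = n₁ * n₂ := by
  unfold IsBisection at hb
  cases b with
  | false => simpa only [ne_eq, Bool.not_eq_false] using hb
  | true =>
    have := card_filter_add_card_filter_not (s := Icc (1 : ℤ) n₁ ×ˢ Icc (1 : ℤ) n₂)
      fun p => h p.1 p.2 = true
    simp only [card_product, Int.card_Icc, add_sub_cancel_right, Int.toNat_natCast] at this
    simp only [ne_eq]
    omega

/-- A bisection of an `n₁ × n₂` grid, `n₁ ≤ n₂`, cuts at least `n₁` edges, and only straight lines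
cut that few. -/
theorem IsBisection.le_cut {n₁ n₂ : ℕ} {h : ℤ → ℤ → Bool} (hb : IsBisection n₁ n₂ h)
    (hpos : 0 < n₁) (hle : n₁ ≤ n₂) :
    (n₁ : ℤ) ≤ rowCut n₁ n₂ h + rowCut n₂ n₁ (fun j i => h i j) ∧
      (rowCut n₁ n₂ h + rowCut n₂ n₁ (fun j i => h i j) = n₁ →
        rowCut n₂ n₁ (fun j i => h i j) = 0 ∨ (n₁ = n₂ ∧ rowCut n₁ n₂ h = 0)) := by
  have hR := card_le_rowCut n₁ n₂ h
  have hC := card_le_rowCut n₂ n₁ fun j i => h i j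
  have p1 := rowCut_nonneg n₁ n₂ h
  have p2 := rowCut_nonneg n₂ n₁ fun j i => h i j
  set R := (Icc (1 : ℤ) n₁).filter fun i => changes (h i) n₂ ≠ 0 with hRdef
  set C := (Icc (1 : ℤ) n₂).filter fun j => changes (fun i => h i j) n₁ ≠ 0 with hCdef
  have cR : (Icc (1 : ℤ) n₁).card = n₁ := by simp
  have cC : (Icc (1 : ℤ) n₂).card = n₂ := by simp
  -- If every row has a change, the rows alone contribute n₁, and equality leaves nothing for the
  -- columns. If every column has one, the columns contribute n₂ ≥ n₁, and equality forces n₁ = n₂.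
  by_cases h1 : R = Icc (1 : ℤ) n₁
  · rw [h1, cR] at hR
    omega
  by_cases h2 : C = Icc (1 : ℤ) n₂
  · rw [h2, cC] at hC
    omega
  obtain ⟨i₀, hi₀, hi₀'⟩ := exists_of_ssubset (filter_subset _ _ |>.ssubset_of_ne h1)
  obtain ⟨j₀, hj₀, hj₀'⟩ := exists_of_ssubset (filter_subset _ _ |>.ssubset_of_ne h2)
  have hrow : ∀ i ∈ Icc (1 : ℤ) n₁, i ∉ R → ∀ j ∈ Icc (1 : ℤ) n₂, h i j = h i j₀ := by
    intro i hi hi' j hj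
    have h0 : changes (h i) n₂ = 0 := by
      by_contra hne
      exact hi' (mem_filter.2 ⟨hi, hne⟩)
    rw [mem_Icc] at hj hj₀
    exact eq_of_changes_eq_zero h0 hj.1 hj.2 hj₀.1 hj₀.2
  have hcol : ∀ j ∈ Icc (1 : ℤ) n₂, j ∉ C → ∀ i ∈ Icc (1 : ℤ) n₁, h i j = h i₀ j := by
    intro j hj hj' i hi
    have h0 : changes (fun i => h i j) n₁ = 0 := by
      by_contra hne
      exact hj' (mem_filter.2 ⟨hj, hne⟩)
    rw [mem_Icc] at hi hi₀
    exact eq_of_changes_eq_zero h0 hi.1 hi.2 hi₀.1 hi₀.2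
  -- Rows and columns without a change meet each other, so they all share the color of (i₀, j₀); the
  -- other color is confined to `R ×ˢ C`.
  have hsub : ((Icc (1 : ℤ) n₁ ×ˢ Icc (1 : ℤ) n₂).filter fun p => h p.1 p.2 ≠ h i₀ j₀) ⊆
      R ×ˢ C := by
    rintro ⟨i, j⟩ hp
    simp only [mem_filter, mem_product] at hp
    obtain ⟨⟨hi, hj⟩, hne⟩ := hp
    rw [mem_product]
    constructor
    · by_contra hiR
      exact hne ((hrow i hi hiR j hj).trans (hcol j₀ hj₀ hj₀' i hi))
    · by_contra hjC
      exact hne ((hcol j hj hjC i hi).trans (hrow i₀ hi₀ hi₀' j hj))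
  have hcard := card_le_card hsub
  rw [card_product] at hcard
  have hb' := hb.card_filter_ne (h i₀ j₀)
  -- The confined color has n₁n₂/2 cells, whereas |R| + |C| ≤ n₁ would give |R||C| ≤ n₁²/4 < n₁n₂/2.
  have hstrict : n₁ < R.card + C.card := by
    by_contra! hcon
    have q1 : n₁ * n₁ ≤ n₁ * n₂ := Nat.mul_le_mul_left _ hle
    nlinarith [sq_nonneg ((R.card : ℤ) - C.card), Nat.mul_le_mul hcon hcon, Nat.mul_pos hpos hpos]
  omega

/-- A bisection of the grid by a straight vertical line. -/
theorem IsBisection.eq_half {n₁ n₂ : ℕ} {h : ℤ → ℤ → Bool} (hb : IsBisection n₁ n₂ h)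
    (hpos : 0 < n₁) (hv : rowCut n₂ n₁ (fun j i => h i j) = 0) (hc : rowCut n₁ n₂ h = n₁) :
    (∀ i j : ℤ, 1 ≤ i → i ≤ n₁ → 1 ≤ j → j ≤ n₂ → (h i j = true ↔ j ≤ half n₂)) ∨
      (∀ i j : ℤ, 1 ≤ i → i ≤ n₁ → 1 ≤ j → j ≤ n₂ → (h i j = true ↔ half n₂ < j)) := by
  have hcol : ∀ i j : ℤ, 1 ≤ i → i ≤ n₁ → 1 ≤ j → j ≤ n₂ → h i j = h 1 j := by
    intro i j h1 h2 h3 h4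
    rw [rowCut, sum_eq_zero_iff_of_nonneg fun _ _ => changes_nonneg _ _] at hv
    exact eq_of_changes_eq_zero (c := fun i => h i j) (hv j (mem_Icc.2 ⟨h3, h4⟩)) h1 h2 le_rfl
      (by omega)
  have hone : changes (h 1) n₂ = 1 := by
    have : rowCut n₁ n₂ h = n₁ * changes (h 1) n₂ := by
      rw [rowCut, sum_congr rfl (g := fun _ => changes (h 1) n₂), sum_const]
      · simp
      · intro i hi
        rw [mem_Icc] at hi
        refine sum_congr rfl fun j hj => ?_
        rw [mem_Ico] at hj
        rw [hcol i j hi.1 hi.2 hj.1 (by omega), hcol i (j + 1) hi.1 hi.2 (by omega) (by omega)]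
    rw [hc] at this
    have hn : (n₁ : ℤ) ≠ 0 := by omega
    exact (mul_left_cancel₀ hn (by rw [← this, mul_one])).symm
  have hcnt : 2 * ((Icc (1 : ℤ) n₂).filter fun j => h 1 j = true).card = n₂ := by
    have : (Icc (1 : ℤ) n₁ ×ˢ Icc (1 : ℤ) n₂).filter (fun p => h p.1 p.2 = true) =
        Icc (1 : ℤ) n₁ ×ˢ (Icc (1 : ℤ) n₂).filter fun j => h 1 j = true := by
      ext ⟨i, j⟩
      simp only [mem_filter, mem_product, mem_Icc]
      constructor
      · rintro ⟨⟨h1, h2⟩, h3⟩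
        exact ⟨h1, h2, by rw [← hcol i j h1.1 h1.2 h2.1 h2.2]; exact h3⟩
      · rintro ⟨h1, h2, h3⟩
        exact ⟨⟨h1, h2⟩, by rw [hcol i j h1.1 h1.2 h2.1 h2.2]; exact h3⟩
    rw [IsBisection, this, card_product, Int.card_Icc, add_sub_cancel_right,
      Int.toNat_natCast] at hb
    refine Nat.eq_of_mul_eq_mul_left hpos ?_
    rw [← hb]; ring
  rcases eq_half_of_changes_eq_one hone hcnt with h' | h'
  · left
    intro i j h1 h2 h3 h4
    rw [hcol i j h1 h2 h3 h4]
    exact h' j h3 h4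
  · right
    intro i j h1 h2 h3 h4
    rw [hcol i j h1 h2 h3 h4]
    exact h' j h3 h4

end Bisection

/-! ### The loss of a permutation and the upper bound -/

section Bound

theorem loss_comm (n : ℕ) (a b : ℤ) : loss n a b = loss n b a := by
  rw [loss, loss, abs_sub_comm, add_comm (offset n a)]

theorem loss_eq_zero {n : ℕ} (hn : Even n) {a b : ℤ} (h : ¬ (a ≤ half n ↔ b ≤ half n)) :
    loss n a b = 0 := by
  obtain ⟨t, rfl⟩ := hn
  simp only [loss, offset, half, abs_eq_max_neg] at h ⊢
  omega

/-- On one side of the center the loss is twice the smaller offset, and offsets are at least 1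
because an even n puts the center between two integers. -/
theorem two_le_loss {n : ℕ} (hn : Even n) {a b : ℤ} (h : a ≤ half n ↔ b ≤ half n) :
    2 ≤ loss n a b := by
  obtain ⟨t, rfl⟩ := hn
  simp only [loss, offset, half, abs_eq_max_neg] at h ⊢
  omega

theorem loss_nonneg {n : ℕ} (hn : Even n) (a b : ℤ) : 0 ≤ loss n a b := by
  by_cases h : a ≤ half n ↔ b ≤ half n
  · linarith [two_le_loss hn h]
  · rw [loss_eq_zero hn h]

theorem isDefect_of_loss_eq_two {n : ℕ} (hn : Even n) {a b : ℤ} (h : loss n a b = 2) :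
    IsDefect n a b (if a ≤ half n then half n else half n + 1) := by
  obtain ⟨t, rfl⟩ := hn
  simp only [loss, offset, half, abs_eq_max_neg, IsDefect] at h ⊢
  split_ifs <;> omega

theorem loss_eq_two_of_isDefect {n : ℕ} (hn : Even n) {a b v : ℤ} (h : IsDefect n a b v)
    (hv : v = half n ∨ v = half n + 1) : loss n a b = 2 := by
  obtain ⟨t, rfl⟩ := hn
  simp only [loss, offset, half, abs_eq_max_neg, IsDefect] at h hv ⊢
  omega

/-- Whether a pair of coordinates is homogeneous. -/
def isHom (n₁ n₂ : ℕ) (p : ℤ × ℤ) : Bool := decide (p.1 ≤ half n₁ ↔ p.2 ≤ half n₂)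

theorem isHom_iff {n₁ n₂ : ℕ} (p : ℤ × ℤ) :
    isHom n₁ n₂ p = true ↔ (p.1 ≤ half n₁ ↔ p.2 ≤ half n₂) := decide_eq_true_iff

theorem homogeneous_iff {n₁ n₂ : ℕ} (x : Cell n₁ n₂) :
    Homogeneous x ↔ isHom n₁ n₂ x.1 = true := by
  simp only [Homogeneous, kind, isHom, decide_eq_decide, decide_eq_true_eq]

/-- If both coordinates change sides, homogeneity is preserved; so where it differs, some coordinate
stays on its side and pays 2. -/
theorem two_mul_le_pairLoss {n₁ n₂ : ℕ} (h₁ : Even n₁) (h₂ : Even n₂) (p q : ℤ × ℤ) :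
    2 * (if isHom n₁ n₂ p = isHom n₁ n₂ q then 0 else 1) ≤ pairLoss n₁ n₂ p q := by
  have e1 := loss_nonneg h₁ p.1 q.1
  have e2 := loss_nonneg h₂ p.2 q.2
  rw [pairLoss]
  split_ifs with h
  · omega
  · by_cases k1 : p.1 ≤ half n₁ ↔ q.1 ≤ half n₁
    · linarith [two_le_loss h₁ k1]
    by_cases k2 : p.2 ≤ half n₂ ↔ q.2 ≤ half n₂
    · linarith [two_le_loss h₂ k2]
    · rw [isHom, isHom, decide_eq_decide] at h
      tauto

/-- The coloring of the cells by homogeneity of the entries. -/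
noncomputable def coloring {n₁ n₂ : ℕ} (π : Equiv.Perm (Cell n₁ n₂)) (i j : ℤ) : Bool :=
  isHom n₁ n₂ (entry π (i, j))

theorem coloring_coe {n₁ n₂ : ℕ} (π : Equiv.Perm (Cell n₁ n₂)) (x : Cell n₁ n₂) :
    coloring π x.1.1 x.1.2 = true ↔ Homogeneous (π x) := by
  rw [homogeneous_iff, coloring, Prod.mk.eta, entry_coe]

theorem edgeSum_isHom {n₁ n₂ : ℕ} (π : Equiv.Perm (Cell n₁ n₂)) :
    edgeSum n₁ n₂ (fun x y => if isHom n₁ n₂ (entry π x) = isHom n₁ n₂ (entry π y)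
      then (0 : ℤ) else 1) =
        rowCut n₁ n₂ (coloring π) + rowCut n₂ n₁ (fun j i => coloring π i j) := by
  rw [edgeSum, sum_comm (s := Ico (1 : ℤ) n₁)]
  rfl

/-- The vertical reflection of the grid. -/
def flipRow (n₁ n₂ : ℕ) : Equiv.Perm (Cell n₁ n₂) :=
  Function.Involutive.toPerm
    (fun x => mkCell (n₁ + 1 - x.1.1) x.1.2 (by have := x.bounds; omega))
    fun x => Cell.ext' (by simp [mkCell]) rfl

/-- The horizontal reflection of the grid. -/
def flipCol (n₁ n₂ : ℕ) : Equiv.Perm (Cell n₁ n₂) :=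
  Function.Involutive.toPerm
    (fun x => mkCell x.1.1 (n₂ + 1 - x.1.2) (by have := x.bounds; omega))
    fun x => Cell.ext' rfl (by simp [mkCell])

theorem flipRow_fst {n₁ n₂ : ℕ} (x : Cell n₁ n₂) : (flipRow n₁ n₂ x).1.1 = n₁ + 1 - x.1.1 := rfl

theorem flipRow_snd {n₁ n₂ : ℕ} (x : Cell n₁ n₂) : (flipRow n₁ n₂ x).1.2 = x.1.2 := rfl

theorem flipCol_fst {n₁ n₂ : ℕ} (x : Cell n₁ n₂) : (flipCol n₁ n₂ x).1.1 = x.1.1 := rfl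

theorem flipCol_snd {n₁ n₂ : ℕ} (x : Cell n₁ n₂) : (flipCol n₁ n₂ x).1.2 = n₂ + 1 - x.1.2 := rfl

/-- As π is a bijection, it suffices to count homogeneous cells of the grid itself. The vertical
reflection changes the side of the first coordinate only, hence exchanges homogeneous and
heterogeneous cells. -/
theorem isBisection_coloring {n₁ n₂ : ℕ} (h₁ : Even n₁) (π : Equiv.Perm (Cell n₁ n₂)) :
    IsBisection n₁ n₂ (coloring π) := by
  have e1 : ∑ x : Cell n₁ n₂, (if isHom n₁ n₂ (π x).1 = true then 1 else 0) =
      ∑ x : Cell n₁ n₂, if isHom n₁ n₂ x.1 = true then 1 else 0 :=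
    Equiv.sum_comp π fun x : Cell n₁ n₂ => if isHom n₁ n₂ x.1 = true then 1 else 0
  have e2 : ∑ x : Cell n₁ n₂, (if isHom n₁ n₂ (flipRow n₁ n₂ x).1 = true then 1 else 0) =
      ∑ x : Cell n₁ n₂, if isHom n₁ n₂ x.1 = true then 1 else 0 :=
    Equiv.sum_comp (flipRow n₁ n₂) fun x : Cell n₁ n₂ => if isHom n₁ n₂ x.1 = true then 1 else 0
  have e3 : ∑ x : Cell n₁ n₂, (if isHom n₁ n₂ x.1 = true then 1 else 0) +
      ∑ x : Cell n₁ n₂, (if isHom n₁ n₂ (flipRow n₁ n₂ x).1 = true then 1 else 0) = n₁ * n₂ := by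
    rw [← sum_add_distrib, sum_congr rfl (g := fun _ => 1)]
    · simp
    · intro x _
      have hb := x.bounds
      have hf : isHom n₁ n₂ (flipRow n₁ n₂ x).1 = true ↔ ¬ isHom n₁ n₂ x.1 = true := by
        obtain ⟨t, rfl⟩ := h₁
        simp only [isHom_iff, flipRow_fst, flipRow_snd, half]
        omega
      by_cases hx : isHom n₁ n₂ x.1 = true
      · rw [if_pos hx, if_neg fun h => hf.1 h hx]
      · rw [if_neg hx, if_pos (hf.2 hx)]
  have e4 := sum_cell (fun x => if isHom n₁ n₂ (π x).1 = true then 1 else 0)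
    (fun i j => if coloring π i j = true then 1 else 0) fun x => by
      rw [coloring, Prod.mk.eta, entry_coe]
  rw [IsBisection, card_filter, sum_product]
  dsimp only
  omega

theorem totalLoss_sub {n₁ n₂ : ℕ} (π : Equiv.Perm (Cell n₁ n₂)) :
    totalLoss π - 2 * (rowCut n₁ n₂ (coloring π) + rowCut n₂ n₁ (fun j i => coloring π i j)) =
      edgeSum n₁ n₂ fun x y => pairLoss n₁ n₂ (entry π x) (entry π y) -
        2 * (if isHom n₁ n₂ (entry π x) = isHom n₁ n₂ (entry π y) then 0 else 1) := by
  rw [← edgeSum_isHom, mul_edgeSum, totalLoss, sub_eq_iff_eq_add, ← edgeSum_add_edgeSum]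
  simp only [sub_add_cancel]

theorem two_mul_cut_le_totalLoss {n₁ n₂ : ℕ} (h₁ : Even n₁) (h₂ : Even n₂)
    (π : Equiv.Perm (Cell n₁ n₂)) :
    2 * (rowCut n₁ n₂ (coloring π) + rowCut n₂ n₁ (fun j i => coloring π i j)) ≤ totalLoss π := by
  rw [← sub_nonneg, totalLoss_sub]
  exact add_nonneg
    (sum_nonneg fun i _ => sum_nonneg fun j _ => sub_nonneg.2 (two_mul_le_pairLoss h₁ h₂ _ _))
    (sum_nonneg fun i _ => sum_nonneg fun j _ => sub_nonneg.2 (two_mul_le_pairLoss h₁ h₂ _ _))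

/-- The slack of each edge is non-negative and the slacks sum to zero. It is symmetric in the two
ends, so the sum can be taken over unordered pairs, which treats both directions at once. -/
theorem pairLoss_eq {n₁ n₂ : ℕ} (h₁ : Even n₁) (h₂ : Even n₂) {π : Equiv.Perm (Cell n₁ n₂)}
    (h : totalLoss π =
      2 * (rowCut n₁ n₂ (coloring π) + rowCut n₂ n₁ (fun j i => coloring π i j)))
    {x y : Cell n₁ n₂} (hxy : l1 x.1 y.1 = 1) :
    pairLoss n₁ n₂ (π x).1 (π y).1 =
      2 * (if isHom n₁ n₂ (π x).1 = isHom n₁ n₂ (π y).1 then 0 else 1) := by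
  let D : Cell n₁ n₂ → Cell n₁ n₂ → ℤ := fun x y => pairLoss n₁ n₂ (π x).1 (π y).1 -
      2 * (if isHom n₁ n₂ (π x).1 = isHom n₁ n₂ (π y).1 then 0 else 1)
  have hD : ∀ x y, D x y = D y x := by
    intro x y
    simp only [D, pairLoss, eq_comm (a := isHom n₁ n₂ (π x).1), loss_comm _ (π x).1.1,
      loss_comm _ (π x).1.2]
  have hs : ∑ e ∈ neighborPairs n₁ n₂, Sym2.lift ⟨D, hD⟩ e = 0 := by
    rw [sum_neighborPairs _ (fun x y => pairLoss n₁ n₂ (entry π x) (entry π y) -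
        2 * (if isHom n₁ n₂ (entry π x) = isHom n₁ n₂ (entry π y) then 0 else 1)),
      ← totalLoss_sub, h, sub_self]
    intro x y
    rw [entry_coe, entry_coe]
    rfl
  rw [sum_eq_zero_iff_of_nonneg] at hs
  · exact sub_eq_zero.1 (hs s(x, y) (mem_filter.2 ⟨mem_univ _, hxy⟩))
  · intro e _
    induction e using Sym2.ind with
    | _ x y => exact sub_nonneg.2 (two_mul_le_pairLoss h₁ h₂ _ _)

/-- The upper bound on the separation, and the three conditions for equality. -/
theorem separation_le_and_eq_iff {n₁ n₂ : ℕ} (h₁ : Even n₁) (h₂ : Even n₂) (hpos : 0 < n₁)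
    (hle : n₁ ≤ n₂) (π : Equiv.Perm (Cell n₁ n₂)) :
    (separation π : ℝ) ≤ (n₁ : ℝ) * n₂ * (n₁ + n₂) - 4 - n₁ -
        minWeight n₁ n₂ (2 * n₁ + 2 * n₂ - 4) ∧
      ((separation π : ℝ) = (n₁ : ℝ) * n₂ * (n₁ + n₂) - 4 - n₁ -
          minWeight n₁ n₂ (2 * n₁ + 2 * n₂ - 4) ↔
        (∀ x ∈ boundaryValues π, ∀ y : Cell n₁ n₂,
          centerDist y < centerDist x → y ∈ boundaryValues π) ∧
        cornerValues π = layer n₁ n₂ 1 ∧ totalLoss π = 2 * n₁) := by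
  obtain ⟨k₁, hk₁⟩ := id h₁
  obtain ⟨k₂, hk₂⟩ := id h₂
  have p₁ : 2 ≤ n₁ := by omega
  have p₂ : 2 ≤ n₂ := by omega
  have hid := two_mul_separation h₁ h₂ hpos (by omega) π
  have hcard : (boundaryValues π).card = 2 * n₁ + 2 * n₂ - 4 := by
    rw [boundaryValues_eq, card_image_of_injective _ π.injective, card_boundaryCells p₁ p₂]
  have hb := two_mul_weight_image (boundaryCells n₁ n₂) π
  rw [← boundaryValues_eq] at hb
  have hb1 := minWeight_le_weight (boundaryValues π)
  have hb2 := weight_eq_minWeight_iff (boundaryValues π)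
  rw [hcard] at hb1 hb2
  have hc1 := eight_le_sum_corner h₁ h₂ p₁ p₂ π
  have hc2 := sum_corner_eq_iff h₁ h₂ p₁ p₂ π
  have hl := (((isBisection_coloring h₁ π).le_cut hpos hle).1)
  have hl2 := two_mul_cut_le_totalLoss h₁ h₂ π
  have hl1 : 2 * (n₁ : ℤ) ≤ totalLoss π := by omega
  rw [← hb2, ← hc2]
  rify at hid hc1 hl1 ⊢
  push_cast at hb
  refine ⟨by linarith, fun h => ⟨by linarith, by linarith, by linarith⟩, ?_⟩
  rintro ⟨e1, e2, e3⟩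
  linarith

end Bound

/-! ### Permutations of least loss with a vertical defect line -/

section Vertical

theorem kind_fst_ne_iff {n₁ n₂ : ℕ} (x y : Cell n₁ n₂) :
    (kind x).1 ≠ (kind y).1 ↔ ¬ (x.1.1 ≤ half n₁ ↔ y.1.1 ≤ half n₁) := by
  rw [kind, kind, ne_eq, decide_eq_decide]

theorem kind_snd_ne_iff {n₁ n₂ : ℕ} (x y : Cell n₁ n₂) :
    (kind x).2 ≠ (kind y).2 ↔ ¬ (x.1.2 ≤ half n₂ ↔ y.1.2 ≤ half n₂) := by
  rw [kind, kind, ne_eq, decide_eq_decide]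

theorem homogeneous_iff' {n₁ n₂ : ℕ} (x : Cell n₁ n₂) :
    Homogeneous x ↔ (x.1.1 ≤ half n₁ ↔ x.1.2 ≤ half n₂) := by
  rw [homogeneous_iff, isHom_iff]

theorem pairLoss_comm (n₁ n₂ : ℕ) (p q : ℤ × ℤ) : pairLoss n₁ n₂ p q = pairLoss n₁ n₂ q p := by
  rw [pairLoss, pairLoss, loss_comm, loss_comm n₂]

theorem totalLoss_eq_of_vertical {n₁ n₂ : ℕ} (h₁ : Even n₁) (h₂ : Even n₂) (p₂ : 2 ≤ n₂)
    {π : Equiv.Perm (Cell n₁ n₂)}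
    (hh : (∀ x, Homogeneous (π x) ↔ x.1.2 ≤ half n₂) ∨ (∀ x, Homogeneous (π x) ↔ half n₂ < x.1.2))
    (hc : ∀ x y : Cell n₁ n₂, l1 x y = 1 → (x.1.2 ≤ half n₂ ↔ y.1.2 ≤ half n₂) →
      (kind (π x)).1 ≠ (kind (π y)).1 ∧ (kind (π x)).2 ≠ (kind (π y)).2)
    (hd : AlternatingDefects π n₁ Prod.fst ∨ AlternatingDefects π n₂ Prod.snd) :
    totalLoss π = 2 * n₁ := by
  have hline : ∀ x y : Cell n₁ n₂, x.1.1 = y.1.1 → x.1.2 = half n₂ → y.1.2 = half n₂ + 1 →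
      pairLoss n₁ n₂ (π x).1 (π y).1 = 2 := by
    intro x y hxy hx hy
    have hb := x.bounds
    have hne : ¬ (Homogeneous (π x) ↔ Homogeneous (π y)) := by
      rcases hh with hh | hh <;> rw [hh, hh] <;> omega
    rw [homogeneous_iff', homogeneous_iff'] at hne
    rw [pairLoss]
    rcases hd with ⟨v, hv, hv', -⟩ | ⟨v, hv, hv', -⟩
    · have hdef := hv x y hxy hx hy
      rw [loss_eq_two_of_isDefect h₁ hdef (hv' _ hb.1 hb.2.1), loss_eq_zero h₂, add_zero]
      simp only [IsDefect] at hdef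
      omega
    · have hdef := hv x y hxy hx hy
      rw [loss_eq_two_of_isDefect h₂ hdef (hv' _ hb.1 hb.2.1), loss_eq_zero h₁, zero_add]
      simp only [IsDefect] at hdef
      omega
  rw [totalLoss, edgeSum_congr (G := fun x y => if x.2 ≤ half n₂ ↔ y.2 ≤ half n₂ then 0 else 2),
    edgeSum]
  · have e1 : ∀ j ∈ Ico (1 : ℤ) n₂, (if j ≤ half n₂ ↔ j + 1 ≤ half n₂ then (0 : ℤ) else 2) =
        if j = half n₂ then 2 else 0 := by
      intro j _
      split_ifs <;> omega
    have e2 : half n₂ ∈ Ico (1 : ℤ) n₂ := by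
      rw [mem_Ico, half]; omega
    simp only [sum_congr rfl e1, sum_ite_eq', e2, if_true, sum_const_zero, add_zero, sum_const,
      Int.card_Icc, nsmul_eq_mul]
    simp [mul_comm]
  · intro x y hxy
    rw [entry_coe, entry_coe]
    split_ifs with hs
    · obtain ⟨a, b⟩ := hc x y hxy hs
      rw [kind_fst_ne_iff] at a
      rw [kind_snd_ne_iff] at b
      rw [pairLoss, loss_eq_zero h₁ a, loss_eq_zero h₂ b, add_zero]
    · rw [l1_eq_one_iff] at hxy
      rcases le_or_gt x.1.2 (half n₂) with hx | hx
      · exact hline x y (by omega) (by omega) (by omega)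
      · rw [pairLoss_comm]
        exact hline y x (by omega) (by omega) (by omega)

theorem eq_xor_of_alternating {c : ℤ → Bool} {n : ℤ}
    (h : ∀ i, 1 ≤ i → i < n → c i ≠ c (i + 1)) {i : ℤ} (hi : 1 ≤ i) (hi' : i ≤ n) :
    (c i = c 1) ↔ i % 2 = 1 := by
  induction i, hi using Int.leInduction with
  | base => simp
  | succ i hi ih =>
    have h1 := ih (by omega)
    have h2 := h i hi (by omega)
    have h3 : c (i + 1) = c 1 ↔ ¬ c i = c 1 := by
      revert h2
      cases c i <;> cases c (i + 1) <;> cases c 1 <;> simp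
    rw [h3, h1]
    omega

/-- Defects of the least possible loss along the bisecting line alternate. -/
theorem alternatingDefects_of_loss {n₁ n₂ n : ℕ} (hn : Even n) (p₂ : 2 ≤ n₂)
    {π : Equiv.Perm (Cell n₁ n₂)} {c : ℤ × ℤ → ℤ}
    (hc : ∀ x y : Cell n₁ n₂, l1 x y = 1 → (x.1.2 ≤ half n₂ ↔ y.1.2 ≤ half n₂) →
      ¬ (c (π x) ≤ half n ↔ c (π y) ≤ half n))
    (hl : ∀ x y : Cell n₁ n₂, x.1.1 = y.1.1 → x.1.2 = half n₂ → y.1.2 = half n₂ + 1 →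
      loss n (c (π x)) (c (π y)) = 2) :
    AlternatingDefects π n c := by
  refine ⟨fun i => if c (entry π (i, half n₂)) ≤ half n then half n else half n + 1, ?_, ?_, ?_⟩
  · intro x y hxy hx hy
    have := isDefect_of_loss_eq_two hn (hl x y hxy hx hy)
    dsimp only
    rw [← hx, Prod.mk.eta, entry_coe]
    exact this
  · intro i _ _
    dsimp only
    split_ifs <;> simp
  · intro i hi hi'
    have hx : entry π (i, half n₂) = (π (mkCell i (half n₂) (by rw [half]; omega))).1 :=
      entry_coe π (mkCell i (half n₂) (by rw [half]; omega))
    have hy : entry π (i + 1, half n₂) = (π (mkCell (i + 1) (half n₂) (by rw [half]; omega))).1 :=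
      entry_coe π (mkCell (i + 1) (half n₂) (by rw [half]; omega))
    have := hc (mkCell i (half n₂) (by rw [half]; omega))
      (mkCell (i + 1) (half n₂) (by rw [half]; omega)) (by simp [mkCell, l1]) Iff.rfl
    dsimp only
    rw [hx, hy]
    split_ifs <;> omega

theorem flipRow_mem_boundary {n₁ n₂ : ℕ} (x : Cell n₁ n₂) :
    flipRow n₁ n₂ x ∈ boundaryCells n₁ n₂ ↔ x ∈ boundaryCells n₁ n₂ := by
  simp only [boundaryCells, mem_filter, mem_univ, true_and, flipRow_fst, flipRow_snd]
  omega

theorem flipCol_mem_boundary {n₁ n₂ : ℕ} (x : Cell n₁ n₂) :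
    flipCol n₁ n₂ x ∈ boundaryCells n₁ n₂ ↔ x ∈ boundaryCells n₁ n₂ := by
  simp only [boundaryCells, mem_filter, mem_univ, true_and, flipCol_fst, flipCol_snd]
  omega

/-- In a double checkerboard, reflection in the horizontal axis changes both coordinates of the
kind. -/
theorem kind_flipRow {n₁ n₂ : ℕ} (h₁ : Even n₁) {π : Equiv.Perm (Cell n₁ n₂)}
    (hc : ∀ x y : Cell n₁ n₂, l1 x y = 1 → (x.1.2 ≤ half n₂ ↔ y.1.2 ≤ half n₂) →
      (kind (π x)).1 ≠ (kind (π y)).1 ∧ (kind (π x)).2 ≠ (kind (π y)).2) (x : Cell n₁ n₂) :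
    (kind (π (flipRow n₁ n₂ x))).1 = !(kind (π x)).1 ∧
      (kind (π (flipRow n₁ n₂ x))).2 = !(kind (π x)).2 := by
  have hb := x.bounds
  obtain ⟨t, ht⟩ := id h₁
  have key : ∀ (f : Cell n₁ n₂ → Bool), (∀ x y : Cell n₁ n₂, l1 x y = 1 →
      (x.1.2 ≤ half n₂ ↔ y.1.2 ≤ half n₂) → f x ≠ f y) → f (flipRow n₁ n₂ x) = !f x := by
    intro f hf
    let c : ℤ → Bool := fun i => if h : 1 ≤ i ∧ i ≤ n₁ then
      f (mkCell i x.1.2 ⟨h.1, h.2, hb.2.2⟩) else false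
    have halt : ∀ i, 1 ≤ i → i < (n₁ : ℤ) → c i ≠ c (i + 1) := by
      intro i hi hi'
      simp only [c]
      rw [dif_pos ⟨hi, hi'.le⟩, dif_pos ⟨by omega, by omega⟩]
      exact hf _ _ (by simp [mkCell, l1]) Iff.rfl
    have e1 : c x.1.1 = f x := dif_pos ⟨hb.1, hb.2.1⟩
    have e2 : c (n₁ + 1 - x.1.1) = f (flipRow n₁ n₂ x) := dif_pos ⟨by omega, by omega⟩
    have q1 := eq_xor_of_alternating halt hb.1 hb.2.1
    have q2 := eq_xor_of_alternating halt (i := n₁ + 1 - x.1.1) (by omega) (by omega)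
    -- Rows i and n₁ + 1 − i have opposite parity because n₁ is even.
    have q3 : f (flipRow n₁ n₂ x) = c 1 ↔ ¬ f x = c 1 := by
      rw [← e1, ← e2, q1, q2]; omega
    revert q3
    cases f (flipRow n₁ n₂ x) <;> cases f x <;> cases c 1 <;> simp
  exact ⟨key (fun x => (kind (π x)).1) fun a b h h' => (hc a b h h').1,
    key (fun x => (kind (π x)).2) fun a b h h' => (hc a b h h').2⟩

/-- Both reflections preserve the boundary. The vertical one flips both coordinates of the kind of
an entry, the horizontal one exchanges the homogeneous half with the heterogeneous half; together
they equate all four counts. -/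
theorem boundary_balanced_of_checkerboard {n₁ n₂ : ℕ} (h₁ : Even n₁) (h₂ : Even n₂)
    {π : Equiv.Perm (Cell n₁ n₂)}
    (hh : (∀ x, Homogeneous (π x) ↔ x.1.2 ≤ half n₂) ∨ (∀ x, Homogeneous (π x) ↔ half n₂ < x.1.2))
    (hc : ∀ x y : Cell n₁ n₂, l1 x y = 1 → (x.1.2 ≤ half n₂ ↔ y.1.2 ≤ half n₂) →
      (kind (π x)).1 ≠ (kind (π y)).1 ∧ (kind (π x)).2 ≠ (kind (π y)).2) (κ κ' : Bool × Bool) :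
    ((boundaryValues π).filter fun x => kind x = κ).card =
      ((boundaryValues π).filter fun x => kind x = κ').card := by
  classical
  let N : Bool × Bool → ℕ := fun κ => ((boundaryCells n₁ n₂).filter fun x => kind (π x) = κ).card
  have hN : ∀ κ, ((boundaryValues π).filter fun x => kind x = κ).card = N κ := by
    intro κ
    rw [boundaryValues_eq, filter_image, card_image_of_injective _ π.injective]
  rw [hN, hN]
  have hV : ∀ κ, N κ = N (!κ.1, !κ.2) := by
    intro κ
    refine card_equiv (flipRow n₁ n₂) fun x => ?_
    obtain ⟨k1, k2⟩ := kind_flipRow h₁ hc x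
    rw [mem_filter, mem_filter, flipRow_mem_boundary, Prod.ext_iff, Prod.ext_iff, k1, k2]
    simp
  have hsplit : ∀ b, ((boundaryCells n₁ n₂).filter
      fun x => decide (Homogeneous (π x)) = b).card = N (true, b) + N (false, !b) := by
    intro b
    rw [← card_union_of_disjoint, ← filter_or]
    · congr 1
      refine filter_congr fun x _ => ?_
      cases b <;> simp only [decide_eq_true_iff, decide_eq_false_iff_not] <;>
        simp only [Homogeneous, Prod.ext_iff] <;> cases (kind (π x)).1 <;> cases (kind (π x)).2 <;> simp
    · refine disjoint_left.2 fun x hx hx' => ?_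
      rw [mem_filter, Prod.ext_iff] at hx hx'
      simp [hx.2.1] at hx'
  have hH : ((boundaryCells n₁ n₂).filter fun x => decide (Homogeneous (π x)) = true).card =
      ((boundaryCells n₁ n₂).filter fun x => decide (Homogeneous (π x)) = false).card := by
    refine card_equiv (flipCol n₁ n₂) fun x => ?_
    have hb := x.bounds
    rw [mem_filter, mem_filter, flipCol_mem_boundary]
    refine and_congr_right fun _ => ?_
    rw [decide_eq_true_iff, decide_eq_false_iff_not]
    obtain ⟨t, rfl⟩ := h₂
    rcases hh with hh | hh <;> rw [hh, hh, flipCol_snd, half] <;> omega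
  rw [hsplit, hsplit] at hH
  have a1 := hV (true, true)
  have a2 := hV (true, false)
  simp only [Bool.not_true, Bool.not_false] at hH a1 a2
  have all : ∀ κ, N κ = N (true, true) := by
    rintro ⟨_ | _, _ | _⟩ <;> omega
  rw [all κ, all κ']

/-- A permutation of least loss whose homogeneous entries are bounded by a vertical line. -/
theorem vertical_of_totalLoss_eq {n₁ n₂ : ℕ} (h₁ : Even n₁) (h₂ : Even n₂) (hpos : 0 < n₁)
    (hle : n₁ ≤ n₂) {π : Equiv.Perm (Cell n₁ n₂)}
    (hlayers : ∀ x ∈ boundaryValues π, ∀ y : Cell n₁ n₂,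
      centerDist y < centerDist x → y ∈ boundaryValues π)
    (hcorners : cornerValues π = layer n₁ n₂ 1) (hloss : totalLoss π = 2 * n₁)
    (hcut : rowCut n₂ n₁ (fun j i => coloring π i j) = 0) : Vertical π := by
  have p₂ : 2 ≤ n₂ := by obtain ⟨t, rfl⟩ := h₁; omega
  have hbis := isBisection_coloring h₁ π
  have hge := (hbis.le_cut hpos hle).1
  have hle2 := two_mul_cut_le_totalLoss h₁ h₂ π
  have hrow : rowCut n₁ n₂ (coloring π) = n₁ := by omega
  have hh : (∀ x, Homogeneous (π x) ↔ x.1.2 ≤ half n₂) ∨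
      (∀ x, Homogeneous (π x) ↔ half n₂ < x.1.2) := by
    refine (hbis.eq_half hpos hcut hrow).imp ?_ ?_ <;>
    · intro h x
      have hb := x.bounds
      rw [← coloring_coe]
      exact h _ _ hb.1 hb.2.1 hb.2.2.1 hb.2.2.2
  have hpair : ∀ x y : Cell n₁ n₂, l1 x.1 y.1 = 1 → pairLoss n₁ n₂ (π x).1 (π y).1 =
      2 * (if isHom n₁ n₂ (π x).1 = isHom n₁ n₂ (π y).1 then 0 else 1) :=
    fun x y hxy => pairLoss_eq h₁ h₂ (by omega) hxy
  have hc : ∀ x y : Cell n₁ n₂, l1 x y = 1 → (x.1.2 ≤ half n₂ ↔ y.1.2 ≤ half n₂) →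
      (kind (π x)).1 ≠ (kind (π y)).1 ∧ (kind (π x)).2 ≠ (kind (π y)).2 := by
    intro x y hxy hxy'
    have hs : isHom n₁ n₂ (π x).1 = isHom n₁ n₂ (π y).1 := by
      rw [Bool.eq_iff_iff, ← homogeneous_iff, ← homogeneous_iff]
      rcases hh with hh | hh <;> rw [hh, hh] <;> omega
    have hp := hpair x y hxy
    rw [if_pos hs, pairLoss] at hp
    have e1 := loss_nonneg h₁ (π x).1.1 (π y).1.1
    have e2 := loss_nonneg h₂ (π x).1.2 (π y).1.2
    rw [kind_fst_ne_iff, kind_snd_ne_iff]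
    constructor <;> intro h
    · have := two_le_loss h₁ h; omega
    · have := two_le_loss h₂ h; omega
  have hline : ∀ x y : Cell n₁ n₂, x.1.1 = y.1.1 → x.1.2 = half n₂ → y.1.2 = half n₂ + 1 →
      ¬ ((kind (π x)).1 = (kind (π y)).1 ↔ (kind (π x)).2 = (kind (π y)).2) ∧
        pairLoss n₁ n₂ (π x).1 (π y).1 = 2 := by
    intro x y hxy hx hy
    have hne : ¬ (Homogeneous (π x) ↔ Homogeneous (π y)) := by
      rcases hh with hh | hh <;> rw [hh, hh] <;> omega
    constructor
    · rw [Homogeneous, Homogeneous] at hne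
      revert hne
      cases (kind (π x)).1 <;> cases (kind (π x)).2 <;> cases (kind (π y)).1 <;>
        cases (kind (π y)).2 <;> simp
    · rw [hpair x y (by rw [l1_eq_one_iff]; omega), if_neg, mul_one]
      rw [Bool.eq_iff_iff, ← homogeneous_iff, ← homogeneous_iff]
      exact hne
  have hd : AlternatingDefects π n₁ Prod.fst ∨ AlternatingDefects π n₂ Prod.snd := by
    let L : ℤ → Bool := fun i => if h : 1 ≤ i ∧ i ≤ n₁ then
      (kind (π (mkCell i (half n₂) (by rw [half]; omega)))).1 else false
    let R : ℤ → Bool := fun i => if h : 1 ≤ i ∧ i ≤ n₁ then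
      (kind (π (mkCell i (half n₂ + 1) (by rw [half]; omega)))).1 else false
    have hL : ∀ i, 1 ≤ i → i < (n₁ : ℤ) → L i ≠ L (i + 1) := by
      intro i hi hi'
      simp only [L]
      rw [dif_pos ⟨hi, hi'.le⟩, dif_pos ⟨by omega, by omega⟩]
      exact (hc (mkCell i (half n₂) _) (mkCell (i + 1) (half n₂) _) (by simp [mkCell, l1])
        Iff.rfl).1
    have hR : ∀ i, 1 ≤ i → i < (n₁ : ℤ) → R i ≠ R (i + 1) := by
      intro i hi hi'
      simp only [R]
      rw [dif_pos ⟨hi, hi'.le⟩, dif_pos ⟨by omega, by omega⟩]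
      exact (hc (mkCell i (half n₂ + 1) _) (mkCell (i + 1) (half n₂ + 1) _) (by simp [mkCell, l1])
        Iff.rfl).1
    -- Both columns next to the line alternate, so whether facing entries agree in the first
    -- coordinate is the same in all rows. The first row thus decides between row defects and column
    -- defects.
    have hLR : ∀ i, 1 ≤ i → i ≤ (n₁ : ℤ) → (L i = R i ↔ L 1 = R 1) := by
      intro i hi hi'
      have a := eq_xor_of_alternating hL hi hi'
      have b := eq_xor_of_alternating hR hi hi'
      have c : L i = L 1 ↔ R i = R 1 := a.trans b.symm
      revert c
      cases L i <;> cases L 1 <;> cases R i <;> cases R 1 <;> simp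
    have hkey : ∀ x y : Cell n₁ n₂, x.1.1 = y.1.1 → x.1.2 = half n₂ → y.1.2 = half n₂ + 1 →
        ((kind (π x)).1 = (kind (π y)).1 ↔ L 1 = R 1) := by
      intro x y hxy hx hy
      have hb := x.bounds
      rw [← hLR x.1.1 hb.1 hb.2.1]
      have e1 : x = mkCell x.1.1 (half n₂) (by rw [half]; omega) := Cell.ext' rfl hx
      have e2 : y = mkCell x.1.1 (half n₂ + 1) (by rw [half]; omega) := Cell.ext' hxy.symm hy
      have e3 : L x.1.1 = (kind (π x)).1 := by
        conv_rhs => rw [e1]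
        exact dif_pos ⟨hb.1, hb.2.1⟩
      have e4 : R x.1.1 = (kind (π y)).1 := by
        conv_rhs => rw [e2]
        exact dif_pos ⟨hb.1, hb.2.1⟩
      rw [e3, e4]
    by_cases h1 : L 1 = R 1
    · left
      refine alternatingDefects_of_loss h₁ p₂
        (fun x y h h' => (kind_fst_ne_iff _ _).1 (hc x y h h').1) fun x y hxy hx hy => ?_
      obtain ⟨a, b⟩ := hline x y hxy hx hy
      have hk := (hkey x y hxy hx hy).2 h1
      have := (kind_snd_ne_iff (π x) (π y)).1 fun h => a (iff_of_true hk h)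
      rw [pairLoss, loss_eq_zero h₂ this, add_zero] at b
      exact b
    · right
      refine alternatingDefects_of_loss h₂ p₂
        (fun x y h h' => (kind_snd_ne_iff _ _).1 (hc x y h h').2) fun x y hxy hx hy => ?_
      obtain ⟨a, b⟩ := hline x y hxy hx hy
      have hk := mt (hkey x y hxy hx hy).1 h1
      rw [pairLoss, loss_eq_zero h₁ ((kind_fst_ne_iff _ _).1 hk), zero_add] at b
      exact b
  exact ⟨hcorners, hh, hc, hlayers, boundary_balanced_of_checkerboard h₁ h₂ hh hc, hd⟩

end Vertical

/-! ### Filling a quarter of the grid -/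

section Filling

/-- A finite set has initial segments of every size with respect to a key. -/
theorem exists_initial_segment {α β : Type*} [Fintype α] [LinearOrder β] (key : α → β)
    {k : ℕ} (hk : k ≤ Fintype.card α) :
    ∃ E : Finset α, E.card = k ∧ ∀ x ∈ E, ∀ y, key y < key x → y ∈ E := by
  classical
  induction k with
  | zero => exact ⟨∅, rfl, by simp⟩
  | succ k ih =>
    obtain ⟨E, hE, hlow⟩ := ih (by omega)
    have hne : Eᶜ.Nonempty := by
      rw [← card_pos, card_compl]; omega
    obtain ⟨m, hm, hmin⟩ := exists_min_image Eᶜ key hne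
    rw [mem_compl] at hm
    refine ⟨insert m E, by rw [card_insert_of_notMem hm, hE], fun x hx y hy => ?_⟩
    by_contra hyE
    rw [mem_insert, not_or] at hyE
    rcases mem_insert.1 hx with rfl | hx
    · exact (hmin y (mem_compl.2 hyE.2)).not_gt hy
    · exact hyE.2 (hlow x hx y hy)

/-- A partial injection that respects two sets of the same size extends to a permutation that
respects them. -/
theorem exists_perm_extending {α : Type*} [Fintype α] [DecidableEq α] {B E P : Finset α}
    {g : α → α} (hBE : B.card = E.card) (hg : Set.InjOn g P) (hP : ∀ x ∈ P, g x ∈ E ↔ x ∈ B) :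
    ∃ φ : Equiv.Perm α, (∀ x ∈ P, φ x = g x) ∧ ∀ x, φ x ∈ E ↔ x ∈ B := by
  have h1 : Fintype.card {x // x ∈ B} = E.card := by rw [Fintype.card_coe, hBE]
  have h2 : Fintype.card {x // ¬ x ∈ B} = Eᶜ.card := by
    rw [Fintype.card_subtype_compl, Fintype.card_coe, card_compl, hBE]
  obtain ⟨e, he⟩ := exists_equiv_extend_of_card_eq h1 (s := P.subtype (· ∈ B))
    (f := fun x => g x.1) (by
      intro y hy
      obtain ⟨x, hx, rfl⟩ := mem_image.1 hy
      exact (hP x.1 (mem_subtype.1 hx)).2 x.2)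
    (fun x hx y hy h => Subtype.ext (hg (mem_subtype.1 hx) (mem_subtype.1 hy) h))
  obtain ⟨f, hf⟩ := exists_equiv_extend_of_card_eq h2 (s := P.subtype (¬ · ∈ B))
    (f := fun x => g x.1) (by
      intro y hy
      obtain ⟨x, hx, rfl⟩ := mem_image.1 hy
      exact mem_compl.2 fun h => x.2 ((hP x.1 (mem_subtype.1 hx)).1 h))
    (fun x hx y hy h => Subtype.ext (hg (mem_subtype.1 hx) (mem_subtype.1 hy) h))
  let f' : {x // ¬ x ∈ B} ≃ {x // ¬ x ∈ E} := f.trans (Equiv.subtypeEquivRight fun x => mem_compl)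
  have hpos : ∀ x (h : x ∈ B), Equiv.subtypeCongr e f' x = (e ⟨x, h⟩).1 := by
    intro x h
    simp [Equiv.subtypeCongr, h]
  have hneg : ∀ x (h : x ∉ B), Equiv.subtypeCongr e f' x = (f ⟨x, h⟩).1 := by
    intro x h
    simp [Equiv.subtypeCongr, h, f']
  refine ⟨Equiv.subtypeCongr e f', fun x hx => ?_, fun x => ?_⟩
  · by_cases h : x ∈ B
    · rw [hpos x h]
      exact he ⟨x, h⟩ (mem_subtype.2 hx)
    · rw [hneg x h]
      exact hf ⟨x, h⟩ (mem_subtype.2 hx)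
  · by_cases h : x ∈ B
    · rw [hpos x h]
      exact iff_of_true (e ⟨x, h⟩).2 h
    · rw [hneg x h]
      exact iff_of_false (mem_compl.1 (f ⟨x, h⟩).2) h

theorem two_mul_sum_Icc_sub (m ρ : ℕ) (h : m ≤ ρ) :
    2 * ∑ a ∈ Icc 1 m, (ρ + 1 - a) = m * (2 * ρ + 1 - m) := by
  induction m with
  | zero => simp
  | succ m ih =>
    rw [sum_Icc_succ_top (by omega), mul_add, ih (by omega)]
    obtain ⟨d, rfl⟩ := Nat.exists_eq_add_of_le h
    have e1 : 2 * (m + 1 + d) + 1 - m = m + 3 + 2 * d := by omega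
    have e2 : m + 1 + d + 1 - (m + 1) = d + 1 := by omega
    have e3 : 2 * (m + 1 + d) + 1 - (m + 1) = m + 2 + 2 * d := by omega
    rw [e1, e2, e3]
    ring

/-- A lower bound for the size of a quarter of a disk. -/
theorem le_two_mul_card_quarter {t₁ t₂ m ρ : ℕ} (h1 : m ≤ t₁) (h2 : m ≤ ρ) (h3 : ρ ≤ t₂)
    {D : Finset (Cell t₁ t₂)} (hD : ∀ y : Cell t₁ t₂, y.1.1 + y.1.2 ≤ ρ + 1 → y ∈ D) :
    m * (2 * ρ + 1 - m) ≤ 2 * D.card := by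
  rw [← two_mul_sum_Icc_sub m ρ h2]
  refine Nat.mul_le_mul_left 2 ?_
  have hs : ((Icc 1 m).sigma fun a => Icc 1 (ρ + 1 - a)).card = ∑ a ∈ Icc 1 m, (ρ + 1 - a) := by
    simp [card_sigma]
  rw [← hs, ← card_attach]
  refine card_le_card_of_injOn (fun p => mkCell (p.1.1 : ℤ) (p.1.2 : ℤ) ?_) ?_ ?_
  · have := p.2
    simp only [mem_sigma, mem_Icc] at this
    omega
  · intro p _
    have := p.2
    simp only [mem_sigma, mem_Icc] at this
    refine hD _ ?_
    simp only [mkCell]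
    omega
  · rintro ⟨⟨a, b⟩, hp⟩ _ ⟨⟨c, d⟩, hq⟩ _ h
    simp only [mkCell, Subtype.mk.injEq, Prod.mk.injEq, Nat.cast_inj] at h
    obtain ⟨rfl, rfl⟩ := h
    rfl

/-- The product is twice the number of quarter cells in the layers up to that of (1, ρ), the first
cell of row 1 that must stay outside the disk. For t₁ = t₂ = 2s the claim is s² − 5s + 3 ≥ 0, which
fails exactly for s = 1, 2, 3, 4; this is where the exceptional squares come from. -/
theorem quarter_bound {t₁ t₂ m ρ : ℕ} (ht : 2 ≤ t₁)
    (hexc : t₁ < t₂ ∨ (t₁ = t₂ ∧ t₁ ≠ 2 ∧ t₁ ≠ 4 ∧ t₁ ≠ 6 ∧ t₁ ≠ 8))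
    (hρ : ρ = t₂ + 1 - t₁ / 2) (hm : m = min t₁ ρ) :
    2 * (t₁ + t₂) ≤ m * (2 * ρ + 1 - m) + 1 := by
  rcases Nat.even_or_odd' t₁ with ⟨s, hs | hs⟩
  · rcases le_or_gt ρ t₁ with h | h
    · rw [min_eq_right h] at hm
      have e : m * (2 * ρ + 1 - m) = ρ * (ρ + 1) := by rw [hm]; congr 1; omega
      rw [e]
      rcases hexc with h' | h'
      · obtain ⟨d, rfl⟩ : ∃ d, ρ = s + 2 + d := ⟨ρ - (s + 2), by omega⟩
        have : t₂ = 2 * s + 1 + d := by omega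
        subst this hs
        nlinarith [sq_nonneg ((s : ℤ) - 1)]
      · have h5 : 5 ≤ s := by omega
        obtain rfl : ρ = s + 1 := by omega
        nlinarith
    · rw [min_eq_left h.le] at hm
      obtain ⟨d, rfl⟩ : ∃ d, ρ = 2 * s + 1 + d := ⟨ρ - (2 * s + 1), by omega⟩
      have e : m * (2 * (2 * s + 1 + d) + 1 - m) = 2 * s * (2 * s + 3 + 2 * d) := by
        rw [hm, hs]; congr 1; omega
      have : t₂ = 3 * s + d := by omega
      rw [e, hs, this]
      nlinarith
  · rcases le_or_gt ρ t₁ with h | h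
    · rw [min_eq_right h] at hm
      have e : m * (2 * ρ + 1 - m) = ρ * (ρ + 1) := by rw [hm]; congr 1; omega
      rw [e]
      rcases hexc with h' | h'
      · obtain ⟨d, rfl⟩ : ∃ d, ρ = s + 3 + d := ⟨ρ - (s + 3), by omega⟩
        have : t₂ = 2 * s + 2 + d := by omega
        subst this hs
        nlinarith
      · obtain rfl : ρ = s + 2 := by omega
        have : t₂ = 2 * s + 1 := by omega
        subst this hs
        rcases Nat.lt_or_ge s 2 with h | h
        · obtain rfl : s = 1 := by omega
          norm_num
        · nlinarith
    · rw [min_eq_left h.le] at hm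
      obtain ⟨d, rfl⟩ : ∃ d, ρ = 2 * s + 2 + d := ⟨ρ - (2 * s + 2), by omega⟩
      have e : m * (2 * (2 * s + 2 + d) + 1 - m) = (2 * s + 1) * (2 * s + 4 + 2 * d) := by
        rw [hm, hs]; congr 1; omega
      have : t₂ = 3 * s + 1 + d := by omega
      rw [e, hs, this]
      nlinarith

/-- A quarter of a layer-by-layer disk of the size of the boundary, that leaves enough cells in
the first row. -/
theorem exists_quarter {t₁ t₂ : ℕ} (p₁ : 1 ≤ t₁) (p₂ : 2 ≤ t₂)
    (hexc : t₁ < t₂ ∨ (t₁ = t₂ ∧ t₁ ≠ 2 ∧ t₁ ≠ 4 ∧ t₁ ≠ 6 ∧ t₁ ≠ 8)) :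
    ∃ E : Finset (Cell t₁ t₂), E.card = t₁ + t₂ - 1 ∧
      (∀ x ∈ E, ∀ y : Cell t₁ t₂, y.1.1 + y.1.2 < x.1.1 + x.1.2 → y ∈ E) ∧
      (∀ x : Cell t₁ t₂, x.1.1 = 1 → x.1.2 ≤ 2 → x ∈ E) ∧
      (∀ x : Cell t₁ t₂, x.1.1 = 1 → (t₂ : ℤ) + 1 - t₁ / 2 ≤ x.1.2 → x ∉ E) := by
  -- Ties within a layer are broken by the column, so the cell in row 1 enters last in its layer and
  -- the first row is used as late as possible.
  let key : Cell t₁ t₂ → ℤ ×ₗ ℤ := fun x => toLex (x.1.1 + x.1.2, x.1.2)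
  have hlt : ∀ x y : Cell t₁ t₂, key x < key y ↔
      x.1.1 + x.1.2 < y.1.1 + y.1.2 ∨ (x.1.1 + x.1.2 = y.1.1 + y.1.2 ∧ x.1.2 < y.1.2) :=
    fun x y => Prod.Lex.toLex_lt_toLex
  obtain ⟨E, hE, hlow⟩ := exists_initial_segment key (k := t₁ + t₂ - 1) (by
    have : Fintype.card (Cell t₁ t₂) = t₁ * t₂ := by simp
    rw [this]
    obtain ⟨a, rfl⟩ := Nat.exists_eq_add_of_le p₁
    obtain ⟨b, rfl⟩ := Nat.exists_eq_add_of_le p₂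
    have : (1 + a) * (2 + b) = 2 + b + 2 * a + a * b := by ring
    rw [this]; omega)
  refine ⟨E, hE, fun x hx y hxy => hlow x hx y ((hlt y x).2 (Or.inl hxy)), ?_, ?_⟩
  · intro x hx hx'
    by_contra hxE
    -- Only (1, 1) and (2, 1) can precede (1, 2), too few for `E`.
    have hall : ∀ y ∈ E, y.1.2 = 1 ∧ y.1.1 ≤ 2 := by
      intro y hy
      have h1 : ¬ key x < key y := fun h => hxE (hlow y hy x h)
      have h2 : y ≠ x := fun h => hxE (h ▸ hy)
      have h3 : ¬ (y.1.1 = x.1.1 ∧ y.1.2 = x.1.2) := fun h => h2 (Cell.ext' h.1 h.2)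
      rw [hlt] at h1
      have := y.bounds
      omega
    rcases Nat.lt_or_ge t₁ 2 with h | h
    · have : E.card ≤ 1 := card_le_one.2 fun a ha b hb => by
        have := hall a ha
        have := hall b hb
        have := a.bounds
        have := b.bounds
        exact Cell.ext' (by omega) (by omega)
      omega
    · have : E ⊆ {mkCell 1 1 (by omega), mkCell 2 1 (by omega)} := by
        intro y hy
        have := hall y hy
        have hb := y.bounds
        rw [mem_insert, mem_singleton]
        rcases (by omega : y.1.1 = 1 ∨ y.1.1 = 2) with h | h
        · exact Or.inl (Cell.ext' h this.1)
        · exact Or.inr (Cell.ext' h this.1)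
      have := (card_le_card this).trans card_le_two
      omega
  · intro x hx hx' hxE
    have hb := x.bounds
    have ht : 2 ≤ t₁ := by omega
    -- With `x`, the set `E` would contain all layers up to that of (1, ρ), hence at least t₁ + t₂
    -- cells, one more than it has.
    have := quarter_bound ht hexc rfl rfl
    have := le_two_mul_card_quarter (m := min t₁ (t₂ + 1 - t₁ / 2)) (ρ := t₂ + 1 - t₁ / 2)
      (D := E) (min_le_left _ _) (min_le_right _ _) (by omega) (by
        intro y hy
        have hyb := y.bounds
        by_cases hxy : y.1.1 = x.1.1 ∧ y.1.2 = x.1.2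
        · rwa [Cell.ext' hxy.1 hxy.2]
        · refine hlow x hxE y ((hlt y x).2 ?_)
          omega)
    omega

/-- The row of the quarter grid whose cell in column `j` represents a cell in the first or in the
last row of the grid. -/
def edgeRow (t₁ t₂ : ℕ) (j : ℤ) : ℤ := if (j - t₂) % 2 = 0 then 1 else t₁

/-- The cells of the quarter grid that represent boundary cells. -/
noncomputable def quarterBoundary (t₁ t₂ : ℕ) : Finset (Cell t₁ t₂) :=
  {x | x.1.2 = 1 ∨ x.1.1 = edgeRow t₁ t₂ x.1.2}

theorem mem_quarterBoundary {t₁ t₂ : ℕ} (x : Cell t₁ t₂) :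
    x ∈ quarterBoundary t₁ t₂ ↔ x.1.2 = 1 ∨ x.1.1 = edgeRow t₁ t₂ x.1.2 := by
  rw [quarterBoundary, mem_filter]
  exact and_iff_right (mem_univ _)

theorem card_quarterBoundary {t₁ t₂ : ℕ} (p₁ : 1 ≤ t₁) (p₂ : 1 ≤ t₂) :
    (quarterBoundary t₁ t₂).card = t₁ + t₂ - 1 := by
  have e1 := sum_cell (n₁ := t₁) (n₂ := t₂)
    (fun x => if x.1.2 = 1 ∨ x.1.1 = edgeRow t₁ t₂ x.1.2 then 1 else 0)
    (fun i j => if j = 1 ∨ i = edgeRow t₁ t₂ j then 1 else 0) fun x => rfl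
  have e2 : ∀ j, ∑ i ∈ Icc (1 : ℤ) t₁, (if j = 1 ∨ i = edgeRow t₁ t₂ j then 1 else 0) =
      1 + if j = 1 then t₁ - 1 else 0 := by
    intro j
    by_cases hj : j = 1
    · simp [hj]; omega
    · have : edgeRow t₁ t₂ j ∈ Icc (1 : ℤ) t₁ := by
        rw [mem_Icc, edgeRow]; split_ifs <;> omega
      simp [hj, this]
  rw [quarterBoundary, card_filter, e1, sum_comm, sum_congr rfl fun j _ => e2 j, sum_add_distrib,
    sum_ite_eq', if_pos (by simpa using p₂)]
  simp
  omega

/-- A way to fill one of the kinds: the boundary is filled with the given cells, the corner with the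
central one, and half of the cells next to the bisecting line get cells in the first row. -/
theorem exists_filling {t₁ t₂ : ℕ} (p₁ : 1 ≤ t₁) (p₂ : 2 ≤ t₂) {E : Finset (Cell t₁ t₂)}
    (hle : t₁ ≤ t₂) (hE : E.card = t₁ + t₂ - 1)
    (hin : ∀ x : Cell t₁ t₂, x.1.1 = 1 → x.1.2 ≤ 2 → x ∈ E)
    (hout : ∀ x : Cell t₁ t₂, x.1.1 = 1 → (t₂ : ℤ) + 1 - t₁ / 2 ≤ x.1.2 → x ∉ E) (par : ℤ) :
    ∃ φ : Equiv.Perm (Cell t₁ t₂), (∀ x, φ x ∈ E ↔ x ∈ quarterBoundary t₁ t₂) ∧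
      (∀ x : Cell t₁ t₂, x.1.2 = 1 → x.1.1 = edgeRow t₁ t₂ 1 →
        (φ x).1.1 = 1 ∧ (φ x).1.2 = 1) ∧
      (∀ x : Cell t₁ t₂, x.1.2 = t₂ → x.1.1 = 1 ∨ x.1.1 % 2 = par → (φ x).1.1 = 1) := by
  classical
  -- Columns of the prescribed row-1 entries: 1 for the corner, 2 for the boundary cell at the line,
  -- and the last t₁/2 columns, outside `E`, for the interior cells at the line. Halving is
  -- injective on rows of one parity.
  let G : Cell t₁ t₂ → ℤ := fun x =>
    if x.1.2 = 1 then 1 else if x.1.1 = 1 then 2 else t₂ + 1 - x.1.1 / 2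
  have hG : ∀ x, 1 ≤ (1 : ℤ) ∧ (1 : ℤ) ≤ t₁ ∧ 1 ≤ G x ∧ G x ≤ t₂ := by
    intro x
    have := x.bounds
    simp only [G]
    split_ifs <;> omega
  let g : Cell t₁ t₂ → Cell t₁ t₂ := fun x => mkCell 1 (G x) (hG x)
  let P : Finset (Cell t₁ t₂) := {x | (x.1.2 = 1 ∧ x.1.1 = edgeRow t₁ t₂ 1) ∨
    (x.1.2 = t₂ ∧ (x.1.1 = 1 ∨ x.1.1 % 2 = par))}
  have hP : ∀ x, x ∈ P ↔ (x.1.2 = 1 ∧ x.1.1 = edgeRow t₁ t₂ 1) ∨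
    (x.1.2 = t₂ ∧ (x.1.1 = 1 ∨ x.1.1 % 2 = par)) := by
    intro x; simp only [P, mem_filter, mem_univ, true_and]
  have hlarge : ∀ x : Cell t₁ t₂, 2 ≤ x.1.1 → (3 : ℤ) ≤ t₂ + 1 - x.1.1 / 2 := by
    intro x hx
    have hb := x.bounds
    by_contra! hlt
    exact hout (mkCell 1 (t₂ + 1 - x.1.1 / 2) (by omega)) rfl (by simp only [mkCell]; omega)
      (hin _ rfl (by simp only [mkCell]; omega))
  obtain ⟨φ, h1, h2⟩ := exists_perm_extending (B := quarterBoundary t₁ t₂) (E := E) (P := P)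
    (g := g) (by rw [card_quarterBoundary p₁ (by omega), hE])
    (by
      intro x hx y hy h
      rw [mem_coe, hP] at hx hy
      have hxb := x.bounds
      have hyb := y.bounds
      have e : G x = G y := congrArg (fun z : Cell t₁ t₂ => z.1.2) h
      have l1 := hlarge x
      have l2 := hlarge y
      simp only [G] at e
      refine Cell.ext' ?_ ?_ <;> split_ifs at e <;> omega)
    (by
      intro x hx
      rw [hP] at hx
      have hb := x.bounds
      rw [mem_quarterBoundary]
      by_cases hx1 : x.1.2 = 1
      · refine iff_of_true (hin _ rfl ?_) (Or.inl hx1)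
        simp only [g, mkCell, G, hx1, if_true]
        omega
      have hx2 : x.1.2 = t₂ := by omega
      have hedge : edgeRow t₁ t₂ t₂ = 1 := by simp [edgeRow]
      rw [hx2, hedge]
      by_cases hx3 : x.1.1 = 1
      · refine iff_of_true (hin _ rfl ?_) (Or.inr hx3)
        simp only [g, mkCell, G, if_neg hx1, if_pos hx3]
        omega
      · refine iff_of_false (hout _ rfl ?_) (by omega)
        simp only [g, mkCell, G, if_neg hx1, if_neg hx3]
        omega)
  refine ⟨φ, h2, fun x hx hx' => ?_, fun x hx hx' => ?_⟩
  · rw [h1 x ((hP x).2 (Or.inl ⟨hx, hx'⟩))]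
    refine ⟨rfl, ?_⟩
    simp only [g, mkCell, G, if_pos hx]
  · rw [h1 x ((hP x).2 (Or.inr ⟨hx, hx'⟩))]
    rfl

/-- One filling serves the even rows along the line and the other the odd rows. Each half thus
spends only about t₁/2 cells of row 1 there, yet every facing pair is covered. -/
theorem exists_filling_pair {t₁ t₂ : ℕ} (p₁ : 1 ≤ t₁) (hle : t₁ ≤ t₂)
    (hexc : t₁ < t₂ ∨ (t₁ = t₂ ∧ t₁ ≠ 2 ∧ t₁ ≠ 4 ∧ t₁ ≠ 6 ∧ t₁ ≠ 8)) :
    ∃ (E : Finset (Cell t₁ t₂)) (φ : Bool → Equiv.Perm (Cell t₁ t₂)),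
      (∀ x ∈ E, ∀ y : Cell t₁ t₂, y.1.1 + y.1.2 < x.1.1 + x.1.2 → y ∈ E) ∧
      (∀ b x, φ b x ∈ E ↔ x ∈ quarterBoundary t₁ t₂) ∧
      (∀ b (x : Cell t₁ t₂), x.1.2 = 1 → x.1.1 = edgeRow t₁ t₂ 1 →
        (φ b x).1.1 = 1 ∧ (φ b x).1.2 = 1) ∧
      (∀ x : Cell t₁ t₂, x.1.2 = t₂ → (φ true x).1.1 = 1 ∨ (φ false x).1.1 = 1) := by
  rcases Nat.lt_or_ge t₂ 2 with h | h
  · have hone : ∀ x : Cell t₁ t₂, x.1.1 = 1 ∧ x.1.2 = 1 := fun x => by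
      have := x.bounds; omega
    exact ⟨univ, fun _ => 1, fun _ _ y _ => mem_univ y,
      fun b x => iff_of_true (mem_univ _) ((mem_quarterBoundary x).2 (Or.inl (hone x).2)),
      fun b x _ _ => hone _, fun x _ => Or.inl (hone _).1⟩
  · obtain ⟨E, hE, hlow, hin, hout⟩ := exists_quarter p₁ h hexc
    obtain ⟨φ, a1, a2, a3⟩ := exists_filling p₁ h hle hE hin hout 0
    obtain ⟨ψ, b1, b2, b3⟩ := exists_filling p₁ h hle hE hin hout 1
    refine ⟨E, fun b => if b then φ else ψ, hlow, ?_, ?_, ?_⟩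
    · rintro (_ | _)
      exacts [b1, a1]
    · rintro (_ | _)
      exacts [b2, a2]
    · intro x hx
      rcases (by omega : x.1.1 % 2 = 0 ∨ x.1.1 % 2 = 1) with h | h
      · exact Or.inl (a3 x hx (Or.inr h))
      · exact Or.inr (b3 x hx (Or.inr h))

end Filling

/-! ### Unfolding the quarter to an optimal permutation -/

section Construction

variable {t₁ t₂ : ℕ}

/-- The cells that get entries with a small first coordinate. -/
def smallCell (x : Cell (2 * t₁) (2 * t₂)) : Bool :=
  decide ((x.1.1 + min x.1.2 (2 * t₂ + 1 - x.1.2) + t₂) % 2 = 1)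

/-- Whether a cell lies in the left half. -/
def leftCell (x : Cell (2 * t₁) (2 * t₂)) : Bool := decide (x.1.2 ≤ t₂)

/-- Fold the grid onto the quarter grid, such that each cell of the quarter grid represents one cell
of every kind. -/
def foldCell (x : Cell (2 * t₁) (2 * t₂)) : Cell t₁ t₂ :=
  mkCell (if smallCell x = true then (x.1.1 + 1) / 2 else (2 * t₁ + 2 - x.1.1) / 2)
    (min x.1.2 (2 * t₂ + 1 - x.1.2)) (by
      have := x.bounds
      push_cast at this
      split_ifs <;> omega)

theorem smallCell_iff (x : Cell (2 * t₁) (2 * t₂)) : smallCell x = true ↔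
    (x.1.1 + min x.1.2 (2 * t₂ + 1 - x.1.2) + t₂) % 2 = 1 := decide_eq_true_iff

theorem leftCell_iff (x : Cell (2 * t₁) (2 * t₂)) : leftCell x = true ↔ x.1.2 ≤ t₂ :=
  decide_eq_true_iff

theorem fold_fst (x : Cell (2 * t₁) (2 * t₂)) : (foldCell x).1.1 =
    if smallCell x = true then (x.1.1 + 1) / 2 else (2 * t₁ + 2 - x.1.1) / 2 := rfl

theorem fold_snd (x : Cell (2 * t₁) (2 * t₂)) :
    (foldCell x).1.2 = min x.1.2 (2 * t₂ + 1 - x.1.2) := rfl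

/-- In a given column smallness fixes the parity of the row, so halving the row index loses nothing.
-/
theorem eq_of_fold_eq {x y : Cell (2 * t₁) (2 * t₂)} (h : foldCell x = foldCell y)
    (hs : smallCell x = smallCell y) (hl : leftCell x = leftCell y) : x = y := by
  have h1 := congrArg (fun z : Cell t₁ t₂ => z.1.1) h
  have h2 := congrArg (fun z : Cell t₁ t₂ => z.1.2) h
  have hx := smallCell_iff x
  have hy := smallCell_iff y
  rw [Bool.eq_iff_iff, leftCell_iff, leftCell_iff] at hl
  rw [fold_snd, fold_snd] at h2
  have hc : x.1.2 = y.1.2 := by omega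
  rw [fold_fst, fold_fst] at h1
  refine Cell.ext' ?_ hc
  rw [← hs] at h1 hy
  split_ifs at h1 with h3
  · have a := hx.1 h3
    have b := hy.1 h3
    omega
  · have a := mt hx.2 h3
    have b := mt hy.2 h3
    omega

/-- Place the cell `q` of the quarter grid into one of the four quarters. -/
def unfoldCell (s l : Bool) (q : Cell t₁ t₂) : Cell (2 * t₁) (2 * t₂) :=
  mkCell (if s = true then t₁ + 1 - q.1.1 else t₁ + q.1.1)
    (if s = l then t₂ + 1 - q.1.2 else t₂ + q.1.2) (by
      have := q.bounds
      push_cast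
      split_ifs <;> omega)

theorem unfold_fst (s l : Bool) (q : Cell t₁ t₂) :
    (unfoldCell s l q).1.1 = if s = true then t₁ + 1 - q.1.1 else t₁ + q.1.1 := rfl

theorem unfold_snd (s l : Bool) (q : Cell t₁ t₂) :
    (unfoldCell s l q).1.2 = if s = l then t₂ + 1 - q.1.2 else t₂ + q.1.2 := rfl

theorem half_two_mul (t : ℕ) : half (2 * t) = t := by
  rw [half]; push_cast; omega

theorem kind_unfold (s l : Bool) (q : Cell t₁ t₂) : kind (unfoldCell s l q) = (s, decide (s = l)) := by
  have := q.bounds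
  rw [kind, half_two_mul, half_two_mul, unfold_fst, unfold_snd, Prod.mk.injEq]
  constructor
  · rw [Bool.eq_iff_iff, decide_eq_true_iff]
    split_ifs with h
    · exact iff_of_true (by omega) h
    · exact iff_of_false (by omega) h
  · rw [decide_eq_decide]
    split_ifs with h
    · exact iff_of_true (by omega) h
    · exact iff_of_false (by omega) h

/-- The offset is independent of `s` and `l`: a layer of the grid is four copies of an antidiagonal
of the quarter, so one layer-by-layer set `E` serves all kinds. -/
theorem cellOffset_unfold (s l : Bool) (q : Cell t₁ t₂) :
    cellOffset (unfoldCell s l q) = 2 * (q.1.1 + q.1.2 - 1) := by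
  have := q.bounds
  rw [cellOffset, unfold_fst, unfold_snd, offset, offset, abs_eq_max_neg, abs_eq_max_neg]
  push_cast
  split_ifs <;> omega

theorem unfold_inj {s l s' l' : Bool} {q q' : Cell t₁ t₂} (h : unfoldCell s l q = unfoldCell s' l' q') :
    s = s' ∧ l = l' ∧ q = q' := by
  have h1 := congrArg kind h
  rw [kind_unfold, kind_unfold, Prod.mk.injEq] at h1
  obtain ⟨rfl, h2⟩ := h1
  have h3 : l = l' := by revert h2; cases s <;> cases l <;> cases l' <;> simp
  subst h3
  refine ⟨rfl, rfl, Cell.ext' ?_ ?_⟩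
  · have := congrArg (fun z : Cell (2 * t₁) (2 * t₂) => z.1.1) h
    rw [unfold_fst, unfold_fst] at this
    split_ifs at this <;> omega
  · have := congrArg (fun z : Cell (2 * t₁) (2 * t₂) => z.1.2) h
    rw [unfold_snd, unfold_snd] at this
    split_ifs at this <;> omega

/-- The permutation of the grid that fills the left half by `φ true` and the right half by
`φ false`. -/
noncomputable def assemble (φ : Bool → Equiv.Perm (Cell t₁ t₂)) :
    Equiv.Perm (Cell (2 * t₁) (2 * t₂)) :=
  Equiv.ofBijective (fun x => unfoldCell (smallCell x) (leftCell x) (φ (leftCell x) (foldCell x)))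
    (Finite.injective_iff_bijective.1 fun x y h => by
      obtain ⟨h1, h2, h3⟩ := unfold_inj h
      rw [h2] at h3
      exact eq_of_fold_eq ((φ _).injective h3) h1 h2)

theorem assemble_apply (φ : Bool → Equiv.Perm (Cell t₁ t₂)) (x : Cell (2 * t₁) (2 * t₂)) :
    assemble φ x = unfoldCell (smallCell x) (leftCell x) (φ (leftCell x) (foldCell x)) := rfl

theorem fold_mem_quarterBoundary (x : Cell (2 * t₁) (2 * t₂)) :
    foldCell x ∈ quarterBoundary t₁ t₂ ↔ x ∈ boundaryCells (2 * t₁) (2 * t₂) := by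
  have hb := x.bounds
  have hs := smallCell_iff x
  rw [mem_quarterBoundary, fold_fst, fold_snd, edgeRow, boundaryCells, mem_filter,
    and_iff_right (mem_univ _)]
  push_cast at hb ⊢
  split_ifs with h1 h2 h2
  · have := hs.1 h1; omega
  · have := hs.1 h1; omega
  · have := mt hs.2 h1; omega
  · have := mt hs.2 h1; omega

theorem exists_separation_eq (p₁ : 1 ≤ t₁) (hle : t₁ ≤ t₂)
    (hexc : t₁ < t₂ ∨ (t₁ = t₂ ∧ t₁ ≠ 2 ∧ t₁ ≠ 4 ∧ t₁ ≠ 6 ∧ t₁ ≠ 8)) :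
    ∃ π : Equiv.Perm (Cell (2 * t₁) (2 * t₂)),
      (∀ x ∈ boundaryValues π, ∀ y : Cell (2 * t₁) (2 * t₂),
        centerDist y < centerDist x → y ∈ boundaryValues π) ∧
      cornerValues π = layer (2 * t₁) (2 * t₂) 1 ∧ totalLoss π = 2 * (2 * t₁ : ℕ) := by
  obtain ⟨E, φ, hlow, hbd, hcorner, hline⟩ := exists_filling_pair p₁ hle hexc
  have hkind : ∀ x, kind (assemble φ x) = (smallCell x, decide (smallCell x = leftCell x)) :=
    fun x => kind_unfold _ _ _
  refine ⟨assemble φ, ?_, ?_, ?_⟩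
  · intro x hx y hxy
    rw [boundaryValues_eq, mem_image] at hx
    obtain ⟨a, ha, rfl⟩ := hx
    obtain ⟨b, rfl⟩ := (assemble φ).surjective y
    rw [boundaryValues_eq]
    refine mem_image_of_mem _ ?_
    rw [centerDist_lt_iff, assemble_apply, assemble_apply, cellOffset_unfold,
      cellOffset_unfold] at hxy
    rw [← fold_mem_quarterBoundary, ← hbd (leftCell b)]
    rw [← fold_mem_quarterBoundary, ← hbd (leftCell a)] at ha
    exact hlow _ ha _ (by omega)
  · rw [← sum_corner_eq_iff (even_two_mul _) (even_two_mul _) (by omega) (by omega),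
      sum_congr rfl (g := fun _ => 2), sum_const, card_cornerCells (by omega) (by omega)]
    · rfl
    · intro x hx
      rw [cornerCells, mem_filter, and_iff_right (mem_univ _)] at hx
      have hs := smallCell_iff x
      push_cast at hx
      have h2 : (foldCell x).1.2 = 1 := by rw [fold_snd]; omega
      have h1 : (foldCell x).1.1 = edgeRow t₁ t₂ 1 := by
        rw [fold_fst, edgeRow]
        split_ifs with a b b
        · have := hs.1 a; omega
        · have := hs.1 a; omega
        · have := mt hs.2 a; omega
        · have := mt hs.2 a; omega
      obtain ⟨c1, c2⟩ := hcorner (leftCell x) (foldCell x) h2 h1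
      rw [assemble_apply, cellOffset_unfold, c1, c2]
      rfl
  · refine totalLoss_eq_of_vertical (even_two_mul _) (even_two_mul _) (by omega) (Or.inl ?_) ?_
      (Or.inl ?_)
    · intro x
      rw [Homogeneous, hkind, half_two_mul, ← leftCell_iff]
      cases smallCell x <;> cases leftCell x <;> simp
    · intro x y hxy hxy'
      rw [half_two_mul, ← leftCell_iff, ← leftCell_iff, ← Bool.eq_iff_iff] at hxy'
      have hs : smallCell x ≠ smallCell y := by
        rw [ne_eq, Bool.eq_iff_iff, smallCell_iff, smallCell_iff]
        rw [Bool.eq_iff_iff, leftCell_iff, leftCell_iff] at hxy'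
        rw [l1_eq_one_iff] at hxy
        omega
      rw [hkind, hkind, ← hxy']
      revert hs
      cases smallCell x <;> cases smallCell y <;> cases leftCell x <;> simp
    -- The summand t₂ in `smallCell` makes the cells at the line small exactly in odd rows. Facing
    -- cells have the same fold, and the one whose entry comes from row 1 of the quarter sets the
    -- defect value.
    · refine ⟨fun i => if i % 2 = 1 then (t₁ : ℤ) else t₁ + 1, ?_, ?_, ?_⟩
      · intro x y hxy hx hy
        rw [half_two_mul] at hx hy
        have hlx : leftCell x = true := (leftCell_iff x).2 (by omega)
        have hly : leftCell y = false := by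
          rw [← Bool.not_eq_true, leftCell_iff]; omega
        have hs : smallCell x = smallCell y := by
          rw [Bool.eq_iff_iff, smallCell_iff, smallCell_iff]; omega
        have hsx : smallCell x = true ↔ x.1.1 % 2 = 1 := by
          rw [smallCell_iff]; omega
        have hf : foldCell x = foldCell y := by
          refine Cell.ext' ?_ ?_
          · rw [fold_fst, fold_fst, hs, hxy]
          · rw [fold_snd, fold_snd]; omega
        have hl := hline (foldCell x) (by rw [fold_snd]; omega)
        rw [assemble_apply, assemble_apply, ← hf, ← hs, hlx, hly, unfold_fst, unfold_fst,
          IsDefect, half_two_mul]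
        have b1 := (φ true (foldCell x)).bounds
        have b2 := (φ false (foldCell x)).bounds
        dsimp only
        by_cases hsm : smallCell x = true
        · rw [if_pos hsm, if_pos hsm, if_pos (hsx.1 hsm)]
          omega
        · rw [if_neg hsm, if_neg hsm, if_neg (mt hsx.2 hsm)]
          omega
      · intro i _ _
        rw [half_two_mul]
        dsimp only
        split_ifs <;> simp
      · intro i _ _
        dsimp only
        split_ifs <;> omega

end Construction

/-! ### Transposition, for square grids -/

section Transpose

theorem entry_transpose {n₁ n₂ : ℕ} (π : Equiv.Perm (Cell n₁ n₂)) (p : ℤ × ℤ) :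
    entry (transpose π) p = (entry π p.swap).swap := by
  have hp : p ∈ Icc (1 : ℤ) n₂ ×ˢ Icc (1 : ℤ) n₁ ↔ p.swap ∈ Icc (1 : ℤ) n₁ ×ˢ Icc (1 : ℤ) n₂ := by
    simp only [mem_product, Prod.fst_swap, Prod.snd_swap, and_comm]
  by_cases h : p ∈ Icc (1 : ℤ) n₂ ×ˢ Icc (1 : ℤ) n₁
  · rw [entry, entry, dif_pos h, dif_pos (hp.1 h)]
    rfl
  · rw [entry, entry, dif_neg h, dif_neg (mt hp.2 h)]
    rfl

theorem separation_transpose {n₁ n₂ : ℕ} (π : Equiv.Perm (Cell n₁ n₂)) :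
    separation (transpose π) = separation π := by
  have hl : ∀ p q : ℤ × ℤ, l1 p.swap q.swap = l1 p q := fun p q => add_comm _ _
  rw [separation_eq_edgeSum, separation_eq_edgeSum, edgeSum, edgeSum, add_comm,
    sum_comm (s := Ico (1 : ℤ) n₂), sum_comm (s := Icc (1 : ℤ) n₂) (t := Ico (1 : ℤ) n₁)]
  simp only [entry_transpose, hl, Prod.swap_prod_mk]

theorem coloring_transpose {n : ℕ} (π : Equiv.Perm (Cell n n)) (i j : ℤ) :
    coloring (transpose π) i j = coloring π j i := by
  rw [coloring, coloring, Bool.eq_iff_iff, isHom_iff, isHom_iff, entry_transpose]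
  exact Iff.comm

end Transpose

theorem separation_eq_iff_mem_family {n₁ n₂ : ℕ} (h₁ : Even n₁) (h₂ : Even n₂) (hpos : 0 < n₁)
    (hle : n₁ ≤ n₂) (π : Equiv.Perm (Cell n₁ n₂)) :
    (separation π : ℝ) = (n₁ : ℝ) * n₂ * (n₁ + n₂) - 4 - n₁ -
      minWeight n₁ n₂ (2 * n₁ + 2 * n₂ - 4) ↔ π ∈ family n₁ n₂ := by
  have p₂ : 2 ≤ n₂ := by obtain ⟨t, rfl⟩ := h₁; omega
  have hvert : ∀ σ : Equiv.Perm (Cell n₁ n₂), Vertical σ →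
      (separation σ : ℝ) = (n₁ : ℝ) * n₂ * (n₁ + n₂) - 4 - n₁ -
        minWeight n₁ n₂ (2 * n₁ + 2 * n₂ - 4) := fun σ h =>
    (separation_le_and_eq_iff h₁ h₂ hpos hle σ).2.2 ⟨h.boundary_layers, h.corners,
      totalLoss_eq_of_vertical h₁ h₂ p₂ h.halves h.checkerboard h.defects⟩
  constructor
  · intro h
    obtain ⟨a, b, c⟩ := (separation_le_and_eq_iff h₁ h₂ hpos hle π).2.1 h
    have hcut := (isBisection_coloring h₁ π).le_cut hpos hle
    have hle2 := two_mul_cut_le_totalLoss h₁ h₂ π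
    rcases hcut.2 (by omega) with h0 | ⟨rfl, h0⟩
    · exact Or.inl (vertical_of_totalLoss_eq h₁ h₂ hpos hle a b c h0)
    · right
      -- Here the coloring is constant along rows. The transpose is also optimal, and its coloring
      -- is constant along columns, so the vertical case applies to it.
      rw [← separation_transpose] at h
      obtain ⟨a, b, c⟩ := (separation_le_and_eq_iff h₁ h₂ hpos hle _).2.1 h
      refine ⟨rfl, vertical_of_totalLoss_eq h₁ h₂ hpos hle a b c ?_⟩
      simp only [coloring_transpose]
      exact h0
  · rintro (h | ⟨rfl, h⟩)
    · exact hvert π h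
    · rw [← separation_transpose]
      exact hvert _ h

end GridSep

theorem mainTheorem1 (n₁ n₂ : ℕ) (hpos : 0 < n₁) (heven₁ : Even n₁) (heven₂ : Even n₂)
    (hle : n₁ ≤ n₂)
    (hexc : n₁ < n₂ ∨ (n₁ = n₂ ∧ n₁ ∉ ({4, 8, 12, 16} : Set ℕ))) :
    (GridSep.family n₁ n₂).Nonempty ∧
    (∀ π : Equiv.Perm (GridSep.Cell n₁ n₂),
      (∀ σ : Equiv.Perm (GridSep.Cell n₁ n₂), GridSep.separation σ ≤ GridSep.separation π) ↔
        π ∈ GridSep.family n₁ n₂) ∧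
    IsGreatest
      (Set.range fun π : Equiv.Perm (GridSep.Cell n₁ n₂) => (GridSep.separation π : ℝ))
      ((n₁ : ℝ) * n₂ * (n₁ + n₂) - 4 - n₁ -
        GridSep.minWeight n₁ n₂ (2 * n₁ + 2 * n₂ - 4)) ∧
    (∀ r : ℕ,
      ∑ i ∈ Finset.Icc 1 r, (GridSep.layer n₁ n₂ i).card ≤ 2 * n₁ + 2 * n₂ - 4 →
      2 * n₁ + 2 * n₂ - 4 ≤ ∑ i ∈ Finset.Icc 1 (r + 1), (GridSep.layer n₁ n₂ i).card →
      GridSep.minWeight n₁ n₂ (2 * n₁ + 2 * n₂ - 4) =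
        ∑ i ∈ Finset.Icc 1 r, (i : ℝ) * (GridSep.layer n₁ n₂ i).card +
          ((r : ℝ) + 1) * ((2 * (n₁ : ℝ) + 2 * n₂ - 4) -
            ∑ i ∈ Finset.Icc 1 r, ((GridSep.layer n₁ n₂ i).card : ℝ))) := by
  have p₁ : 2 ≤ n₁ := by obtain ⟨t, rfl⟩ := heven₁; omega
  have hbound := fun π => (GridSep.separation_le_and_eq_iff heven₁ heven₂ hpos hle π).1
  have hfam := GridSep.separation_eq_iff_mem_family heven₁ heven₂ hpos hle
  have hex : ∃ π : Equiv.Perm (GridSep.Cell n₁ n₂), (GridSep.separation π : ℝ) =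
      (n₁ : ℝ) * n₂ * (n₁ + n₂) - 4 - n₁ -
        GridSep.minWeight n₁ n₂ (2 * n₁ + 2 * n₂ - 4) := by
    simp only [Set.mem_insert_iff, Set.mem_singleton_iff, not_or] at hexc
    obtain ⟨t₁, rfl⟩ := heven₁.two_dvd
    obtain ⟨t₂, rfl⟩ := heven₂.two_dvd
    obtain ⟨π, h⟩ := GridSep.exists_separation_eq (t₁ := t₁) (t₂ := t₂) (by omega) (by omega)
      (by omega)
    exact ⟨π, (GridSep.separation_le_and_eq_iff heven₁ heven₂ hpos hle π).2.2 h⟩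
  obtain ⟨π₀, h₀⟩ := hex
  refine ⟨⟨π₀, (hfam π₀).1 h₀⟩, fun π => ?_, ⟨⟨π₀, h₀⟩, ?_⟩, fun r hr hr' => ?_⟩
  · rw [← hfam π]
    constructor
    · intro h
      refine le_antisymm (hbound π) ?_
      rw [← h₀]
      exact_mod_cast h π₀
    · intro h σ
      have := hbound σ
      rw [← h] at this
      exact_mod_cast this
  · rintro _ ⟨π, rfl⟩
    exact hbound π
  -- This is (n₁ − 2)(n₂ − 2) ≥ 0.
  · have hk : 2 * n₁ + 2 * n₂ - 4 ≤ n₁ * n₂ := by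
      obtain ⟨a, rfl⟩ := Nat.exists_eq_add_of_le p₁
      obtain ⟨b, rfl⟩ := Nat.exists_eq_add_of_le (p₁.trans hle)
      have : (2 + a) * (2 + b) = 4 + 2 * a + 2 * b + a * b := by ring
      omega
    rw [GridSep.minWeight_eq heven₁ heven₂ hk hr hr', Nat.cast_sub (by omega)]
    push_cast
    rfl
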